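/- Let $A$ and $B$ be separable $C^*$-algebras. A *strict positive $A$--$B$-correspondence* $(\rho, X)$ is a right Hilbert $B$-module $X$ together with a completely positive map $\rho\colon A\to \mathrm{End}_B(X)$ into the adjointable operators that is strict, i.e. for some approximate unit $(a_i)$ of $A$ the net $(\rho(a_i))$ is strictly Cauchy: $(\rho(a_i)x)$ and $(\rho(a_i)^*x)$ are norm-Cauchy for all $x\in X$. Two such pairs $(\rho,X)$, $(\sigma,Y)$ are isomorphic if there is an adjointable unitary $U\colon X\to Y$ with $U\rho(a)U^*=\sigma(a)$ for all $a\in A$. The morphisms $A\to B$ of the positive correspondence semi-category are the isomorphism classes of strict positive $A$--$B$-correspondences. The composition of $(\rho,X)\colon A\to B$ and $(\sigma,Y)\colon B\to C$ is the class of $$(\rho,X)\otimes(\sigma,Y) = \bigl(\rho\otimes \mathrm{Id},\; X\otimes_B (B\otimes_\sigma Y)\bigr),$$ where $(\pi_\sigma, B\otimes_\sigma Y)$ is the KSGNS correspondence of $\sigma$: the Hausdorff completion of the algebraic tensor product $B\odot Y$ for $\langle b\otimes y\mid b'\otimes y'\rangle=\langle y\mid\sigma(b^*b')y'\rangle_C$,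 with left action $\pi_\sigma(b')(b\otimes y)=b'b\otimes y$, and $\otimes_B$ is the internal tensor product. With $A$ acting on $A_A$ by left multiplication, $(\mathrm{Id},A_A)$ is a right identity of $A$. A morphism $m\colon A\to B$ is *invertible* if there is a morphism $n\colon B\to A$ such that $m\otimes n=(\mathrm{Id},A_A)$ and $n\otimes m=(\mathrm{Id},B_B)$. A *Morita equivalence bimodule* is a pair $(\phi,X)$ consisting of a countably generated right Hilbert $B$-module $X$ that is full, i.e. the linear span of $\{\langle x\mid y\rangle_B : x,y\in X\}$ is dense in $B$, and an injective $*$-homomorphism $\phi\colon A\to\mathrm{End}_B(X)$ whose range is exactly the algebra $\mathrm{End}^0_B(X)$ of compact operators (the closed linear span of the rank-one operators $z\mapsto x\langle y\mid z\rangle_B$). **Lemma.** Every Morita equivalence bimodule $(\phi, X)$ is a strict positive $A$--$B$-correspondence, and a morphism $A\to B$ of the positive correspondence semi-category is invertible if and only if it is the class of a Morita equivalence bimodule. -/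

import Mathlib

open scoped TensorProduct CStarAlgebra ComplexOrder
open MulOpposite

universe u

namespace Quesadilla

noncomputable section

set_option linter.unusedSectionVars false

section Inner

variable {B X : Type*} [NonUnitalCStarAlgebra B] [PartialOrder B] [StarOrderedRing B]
  [NormedAddCommGroup X] [NormedSpace ℂ X] [SMul Bᵐᵒᵖ X] [CStarModule Bᵐᵒᵖ X]

/-- The `B`-valued inner product of a right Hilbert `B`-module `X`, linear in the second variable.
A right Hilbert `B`-module is a `CStarModule` over `Bᵐᵒᵖ`, with `op b • x` standing for `x b`;
its inner product takes values in `Bᵐᵒᵖ`, and `rip` reads them in `B`. -/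
def rip (B : Type*) {X : Type*} [Inner Bᵐᵒᵖ X] (x y : X) : B := (inner Bᵐᵒᵖ x y).unop

lemma rip_add_right (x y z : X) : rip B x (y + z) = rip B x y + rip B x z := by
  simp [rip]

lemma rip_add_left (x y z : X) : rip B (x + y) z = rip B x z + rip B y z := by
  simp [rip]

lemma rip_smul_right (c : ℂ) (x y : X) : rip B x (c • y) = c • rip B x y := by
  simp [rip]

lemma rip_smul_left (c : ℂ) (x y : X) : rip B (c • x) y = star c • rip B x y := by
  simp [rip]

lemma rip_act_right (b : B) (x y : X) : rip B x (op b • y) = rip B x y * b := by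
  simp [rip]

lemma star_rip (x y : X) : star (rip B x y) = rip B y x := by
  simp only [rip, ← unop_star, CStarModule.star_inner]

lemma rip_act_left (b : B) (x y : X) : rip B (op b • x) y = star b * rip B x y := by
  rw [← star_rip, rip_act_right, star_mul, star_rip]

lemma rip_sub_right (x y z : X) : rip B x (y - z) = rip B x y - rip B x z := by
  simp [rip]

lemma rip_sub_left (x y z : X) : rip B (x - y) z = rip B x z - rip B y z := by
  simp [rip]

lemma rip_zero_right (x : X) : rip B x 0 = 0 := by simp [rip]

lemma rip_sum_right {ι : Type*} (s : Finset ι) (x : X) (y : ι → X) :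
    rip B x (∑ i ∈ s, y i) = ∑ i ∈ s, rip B x (y i) := by
  simp [rip]

lemma rip_sum_left {ι : Type*} (s : Finset ι) (x : ι → X) (y : X) :
    rip B (∑ i ∈ s, x i) y = ∑ i ∈ s, rip B (x i) y := by
  simp [rip]

lemma rip_self_nonneg (x : X) : 0 ≤ rip B x x :=
  CStarModule.inner_self_nonneg (A := Bᵐᵒᵖ)

lemma rip_self_eq_zero {x : X} : rip B x x = 0 ↔ x = 0 := by
  rw [rip, unop_eq_zero_iff, CStarModule.inner_self]

lemma norm_sq_eq_rip (x : X) : ‖x‖ ^ 2 = ‖rip B x x‖ :=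
  CStarModule.norm_sq_eq Bᵐᵒᵖ

lemma norm_rip_le (x y : X) : ‖rip B x y‖ ≤ ‖x‖ * ‖y‖ :=
  CStarModule.norm_inner_le (A := Bᵐᵒᵖ) X

lemma rip_ext_right {x y : X} (h : ∀ z, rip B z x = rip B z y) : x = y := by
  rw [← sub_eq_zero, ← rip_self_eq_zero (B := B), rip_sub_right, h, sub_self]

lemma rip_ext_left {x y : X} (h : ∀ z, rip B x z = rip B y z) : x = y :=
  rip_ext_right (B := B) fun z ↦ by rw [← star_rip, h, star_rip]

lemma continuous_rip : Continuous fun p : X × X ↦ rip B p.1 p.2 :=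
  continuous_unop.comp (CStarModule.continuous_inner (A := Bᵐᵒᵖ))

lemma continuous_rip_comp {α : Type*} [TopologicalSpace α] {f g : α → X} (hf : Continuous f)
    (hg : Continuous g) : Continuous fun a ↦ rip B (f a) (g a) :=
  continuous_rip.comp (hf.prodMk hg)

lemma norm_op_smul_le (b : B) (x : X) : ‖op b • x‖ ≤ ‖b‖ * ‖x‖ := by
  refine abs_le_of_sq_le_sq' ?_ (by positivity) |>.2
  rw [norm_sq_eq_rip (B := B), rip_act_right, rip_act_left, mul_pow, norm_sq_eq_rip (B := B) x]
  calc _ ≤ ‖star b‖ * ‖rip B x x‖ * ‖b‖ := by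
        refine (norm_mul_le _ _).trans ?_
        gcongr
        exact norm_mul_le _ _
    _ = _ := by rw [norm_star]; ring

end Inner

section Adjointable

variable (B X Y Z : Type*) [NonUnitalCStarAlgebra B] [PartialOrder B] [StarOrderedRing B]
  [NormedAddCommGroup X] [NormedSpace ℂ X] [SMul Bᵐᵒᵖ X] [CStarModule Bᵐᵒᵖ X]
  [NormedAddCommGroup Y] [NormedSpace ℂ Y] [SMul Bᵐᵒᵖ Y] [CStarModule Bᵐᵒᵖ Y]

/-- The algebra of the bounded operators `T` on `X` that have an adjoint with respect to the
`B`-valued inner product. -/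
def adjointableSubalgebra : Subalgebra ℂ (X →L[ℂ] X) where
  carrier := {T | ∃ S : X →L[ℂ] X, ∀ x y, rip B (T x) y = rip B x (S y)}
  mul_mem' := by
    rintro T T' ⟨S, hS⟩ ⟨S', hS'⟩
    exact ⟨S' * S, fun x y ↦ by simp [hS, hS']⟩
  add_mem' := by
    rintro T T' ⟨S, hS⟩ ⟨S', hS'⟩
    exact ⟨S + S', fun x y ↦ by simp [hS, hS', rip_add_left, rip_add_right]⟩
  algebraMap_mem' c := ⟨star c • 1, fun x y ↦ by
    simp [Algebra.algebraMap_eq_smul_one, rip_smul_left, rip_smul_right]⟩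

/-- The C⋆-algebra `End_B(X)` of adjointable operators on the right Hilbert `B`-module `X`. -/
def Adj : Type _ := adjointableSubalgebra B X

namespace Adj

instance : NormedRing (Adj B X) := inferInstanceAs (NormedRing (adjointableSubalgebra B X))
instance : NormedAlgebra ℂ (Adj B X) :=
  inferInstanceAs (NormedAlgebra ℂ (adjointableSubalgebra B X))

variable {B X Y}

/-- The underlying bounded operator. -/
def toCLM (T : Adj B X) : X →L[ℂ] X := T.1

instance : CoeFun (Adj B X) fun _ ↦ X → X := ⟨fun T ↦ T.toCLM⟩

/-- An adjointable operator from a bounded operator and an adjoint. -/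
def mk (T S : X →L[ℂ] X) (h : ∀ x y, rip B (T x) y = rip B x (S y)) : Adj B X := ⟨T, S, h⟩

@[simp] lemma mk_apply (T S : X →L[ℂ] X) (h : ∀ x y, rip B (T x) y = rip B x (S y)) (x : X) :
    mk T S h x = T x := rfl

@[ext] lemma ext {T S : Adj B X} (h : ∀ x, T x = S x) : T = S :=
  Subtype.ext (ContinuousLinearMap.ext h)

@[simp] lemma add_apply (T S : Adj B X) (x : X) : (T + S) x = T x + S x := rfl
@[simp] lemma sub_apply (T S : Adj B X) (x : X) : (T - S) x = T x - S x := rfl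
@[simp] lemma mul_apply (T S : Adj B X) (x : X) : (T * S) x = T (S x) := rfl
@[simp] lemma smul_apply (c : ℂ) (T : Adj B X) (x : X) : (c • T) x = c • T x := rfl
@[simp] lemma one_apply (x : X) : (1 : Adj B X) x = x := rfl
@[simp] lemma zero_apply (x : X) : (0 : Adj B X) x = 0 := rfl
lemma norm_def (T : Adj B X) : ‖T‖ = ‖T.toCLM‖ := rfl
lemma norm_apply_le (T : Adj B X) (x : X) : ‖T x‖ ≤ ‖T‖ * ‖x‖ := T.toCLM.le_opNorm x

instance : Star (Adj B X) where
  star T := mk T.2.choose T.1 fun x y ↦ by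
    rw [← star_rip, ← T.2.choose_spec, star_rip]

lemma rip_star_right (T : Adj B X) (x y : X) : rip B x (star T y) = rip B (T x) y :=
  (T.2.choose_spec x y).symm

lemma rip_star_left (T : Adj B X) (x y : X) : rip B (star T x) y = rip B x (T y) := by
  rw [← star_rip, rip_star_right, star_rip]

lemma norm_mul_self_le (T : Adj B X) : ‖T‖ * ‖T‖ ≤ ‖star T * T‖ := by
  have h : ‖T‖ ≤ √‖star T * T‖ := by
    refine T.toCLM.opNorm_le_bound (Real.sqrt_nonneg _) fun x ↦ ?_
    refine abs_le_of_sq_le_sq' ?_ (by positivity) |>.2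
    rw [norm_sq_eq_rip (B := B), ← rip_star_right, mul_pow, Real.sq_sqrt (norm_nonneg _)]
    calc _ ≤ ‖x‖ * ‖(star T * T) x‖ := norm_rip_le _ _
      _ ≤ ‖x‖ * (‖star T * T‖ * ‖x‖) := by gcongr; exact norm_apply_le _ _
      _ = _ := by ring
  calc ‖T‖ * ‖T‖ ≤ √‖star T * T‖ * √‖star T * T‖ := by gcongr
    _ = _ := Real.mul_self_sqrt (norm_nonneg _)

lemma isometry_toCLM : Isometry (toCLM : Adj B X → X →L[ℂ] X) := isometry_subtype_coe

instance : StarRing (Adj B X) where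
  star_involutive T := ext fun x ↦ rip_ext_right (B := B) fun z ↦ by
    rw [rip_star_right, rip_star_left]
  star_mul S T := ext fun x ↦ rip_ext_right (B := B) fun z ↦ by
    simp only [rip_star_right, mul_apply]
  star_add S T := ext fun x ↦ rip_ext_right (B := B) fun z ↦ by
    simp only [rip_star_right, add_apply, rip_add_left, rip_add_right]

instance : StarModule ℂ (Adj B X) where
  star_smul c T := ext fun x ↦ rip_ext_right (B := B) fun z ↦ by
    simp only [rip_star_right, smul_apply, rip_smul_left, rip_smul_right]

instance : CStarRing (Adj B X) where
  norm_mul_self_le := norm_mul_self_le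

instance [CompleteSpace X] : CompleteSpace (Adj B X) := by
  refine Metric.complete_of_cauchySeq_tendsto fun u hu ↦ ?_
  have h₁ : CauchySeq fun n ↦ (u n).toCLM :=
    isometry_toCLM.uniformContinuous.comp_cauchySeq hu
  have h₂ : CauchySeq fun n ↦ (star (u n)).toCLM :=
    isometry_toCLM.uniformContinuous.comp_cauchySeq
      ((starₗᵢ ℂ (E := Adj B X)).isometry.uniformContinuous.comp_cauchySeq hu)
  obtain ⟨T, hT⟩ := cauchySeq_tendsto_of_complete h₁
  obtain ⟨S, hS⟩ := cauchySeq_tendsto_of_complete h₂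
  refine ⟨mk T S fun x y ↦ ?_, ?_⟩
  · have hTx : Filter.Tendsto (fun n ↦ u n x) .atTop (nhds (T x)) :=
      ((ContinuousLinearMap.apply ℂ X x).continuous.tendsto T).comp hT
    have hSy : Filter.Tendsto (fun n ↦ star (u n) y) .atTop (nhds (S y)) :=
      ((ContinuousLinearMap.apply ℂ X y).continuous.tendsto S).comp hS
    refine tendsto_nhds_unique
      (((continuous_rip_comp (B := B) continuous_id continuous_const).tendsto _).comp hTx) ?_
    have := ((continuous_rip_comp (B := B) (f := fun _ : X ↦ x)
      continuous_const continuous_id).tendsto _).comp hSy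
    refine this.congr fun n ↦ ?_
    simp only [Function.comp_apply, id, rip_star_right]
  · exact isometry_toCLM.isEmbedding.tendsto_nhds_iff.2 hT

instance [CompleteSpace X] : CStarAlgebra (Adj B X) where

instance [CompleteSpace X] : PartialOrder (Adj B X) := CStarAlgebra.spectralOrder _
instance [CompleteSpace X] : StarOrderedRing (Adj B X) := CStarAlgebra.spectralOrderedRing _

variable (B) in
/-- The bounded operator `z ↦ x ⟨y, z⟩`. -/
def rankOneCLM (x y : X) : X →L[ℂ] X :=
  LinearMap.mkContinuous
    { toFun := fun z ↦ op (rip B y z) • x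
      map_add' := fun z z' ↦ rip_ext_right (B := B) fun w ↦ by
        simp only [rip_add_right, rip_act_right, mul_add]
      map_smul' := fun c z ↦ rip_ext_right (B := B) fun w ↦ by
        simp only [rip_smul_right, rip_act_right, mul_smul_comm, RingHom.id_apply] }
    (‖x‖ * ‖y‖) fun z ↦ by
      refine (norm_op_smul_le _ _).trans ?_
      calc _ ≤ ‖y‖ * ‖z‖ * ‖x‖ := by gcongr; exact norm_rip_le _ _
        _ = _ := by ring

variable (B) in
/-- The rank-one operator `Θ_{x,y} : z ↦ x ⟨y, z⟩`, whose adjoint is `Θ_{y,x}`. -/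
def rankOne (x y : X) : Adj B X :=
  mk (rankOneCLM B x y) (rankOneCLM B y x) fun z w ↦ by
    simp only [rankOneCLM, LinearMap.mkContinuous_apply, LinearMap.coe_mk, AddHom.coe_mk,
      rip_act_left, rip_act_right, star_rip]

variable (B X) in
/-- The ideal `End⁰_B(X)` of compact operators: the closed linear span of the rank-one operators. -/
def compacts : Submodule ℂ (Adj B X) :=
  (Submodule.span ℂ {T | ∃ x y : X, T = rankOne B x y}).topologicalClosure

end Adj

end Adjointable

section SemiInner

/-- A right semi-inner product module over `B`: a complex vector space `V` with a right action
of `B` and a positive semidefinite `B`-valued sesquilinear form. -/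
structure SemiInner (B V : Type*) [NonUnitalCStarAlgebra B] [PartialOrder B] [AddCommGroup V]
    [Module ℂ V] where
  form : V →ₗ⋆[ℂ] V →ₗ[ℂ] B
  act : B → V →ₗ[ℂ] V
  form_act : ∀ b v w, form v (act b w) = form v w * b
  star_form : ∀ v w, star (form v w) = form w v
  form_self_nonneg : ∀ v, 0 ≤ form v v

namespace SemiInner

variable {B V : Type*} [NonUnitalCStarAlgebra B] [PartialOrder B] [StarOrderedRing B]
  [AddCommGroup V] [Module ℂ V] (S : SemiInner B V)

lemma form_act_left (b : B) (v w : V) : S.form (S.act b v) w = star b * S.form v w := by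
  rw [← S.star_form, form_act, star_mul, S.star_form]

lemma cauchy_schwarz_aux (v w : V) {c : ℝ} (hc : 0 < c) (h : ‖S.form v v‖ ≤ c) :
    ‖S.form v w‖ ^ 2 ≤ c * ‖S.form w w‖ := by
  set b := S.form v w with hb
  have hvv : star b * S.form v v * b ≤ c • (star b * b) := by
    refine (CStarAlgebra.star_left_conjugate_le_norm_smul (S.star_form v v)).trans ?_
    exact smul_le_smul_of_nonneg_right h (star_mul_self_nonneg b)
  have h₁ := S.form_self_nonneg (((c⁻¹ : ℝ) : ℂ) • S.act b v - w)
  have h₂ : S.form (((c⁻¹ : ℝ) : ℂ) • S.act b v - w) (((c⁻¹ : ℝ) : ℂ) • S.act b v - w) =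
      (c⁻¹ * c⁻¹ : ℝ) • (star b * S.form v v * b) - (2 * c⁻¹ : ℝ) • (star b * b)
        + S.form w w := by
    have hw : S.form w v = star b := by rw [hb, S.star_form]
    simp only [map_sub, map_smul, LinearMap.map_smulₛₗ, LinearMap.sub_apply, LinearMap.smul_apply,
      form_act, form_act_left, hw, ← hb, Complex.conj_ofReal]
    simp only [Complex.coe_smul]
    module
  have h₃ : star b * b ≤ c • S.form w w := by
    rw [h₂] at h₁
    have h₄ : (c⁻¹ * c⁻¹ : ℝ) • (star b * S.form v v * b) ≤
        (c⁻¹ * c⁻¹ : ℝ) • c • (star b * b) := smul_le_smul_of_nonneg_left hvv (by positivity)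
    have h₅ : 0 ≤ S.form w w - c⁻¹ • (star b * b) := by
      refine h₁.trans ((add_le_add_left (sub_le_sub_right h₄ _) _).trans_eq ?_)
      rw [smul_smul, mul_assoc, inv_mul_cancel₀ hc.ne', mul_one]
      module
    have h₆ := smul_le_smul_of_nonneg_left (sub_nonneg.1 h₅) hc.le
    rwa [smul_smul, mul_inv_cancel₀ hc.ne', one_smul] at h₆
  calc ‖b‖ ^ 2 = ‖star b * b‖ := by rw [CStarRing.norm_star_mul_self, sq]
    _ ≤ ‖c • S.form w w‖ := CStarAlgebra.norm_le_norm_of_nonneg_of_le (star_mul_self_nonneg b) h₃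
    _ = c * ‖S.form w w‖ := by rw [norm_smul, Real.norm_of_nonneg hc.le]

lemma cauchy_schwarz (v w : V) : ‖S.form v w‖ ^ 2 ≤ ‖S.form v v‖ * ‖S.form w w‖ := by
  refine ge_of_tendsto (f := fun c : ℝ ↦ (‖S.form v v‖ + c) * ‖S.form w w‖)
    (x := nhdsWithin 0 (Set.Ioi 0)) ?_ ?_
  · refine Filter.Tendsto.mono_left ?_ nhdsWithin_le_nhds
    exact Continuous.tendsto' (by fun_prop) _ _ (by simp)
  · filter_upwards [self_mem_nhdsWithin] with c hc
    have hc : 0 < c := hc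
    exact S.cauchy_schwarz_aux v w (by positivity) (by linarith)

/-- The vector space `V` with the seminorm `‖v‖ = ‖⟨v, v⟩‖ ^ (1 / 2)`. -/
def Pre (_ : SemiInner B V) : Type _ := V

instance : AddCommGroup S.Pre := inferInstanceAs (AddCommGroup V)
instance : Module ℂ S.Pre := inferInstanceAs (Module ℂ V)

/-- The identity map to the seminormed copy. -/
def toPre : V ≃ₗ[ℂ] S.Pre := LinearEquiv.refl ℂ V

instance : Norm S.Pre := ⟨fun v ↦ √‖S.form (S.toPre.symm v) (S.toPre.symm v)‖⟩

lemma pre_norm_sq (v : S.Pre) : ‖v‖ ^ 2 = ‖S.form (S.toPre.symm v) (S.toPre.symm v)‖ :=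
  Real.sq_sqrt (norm_nonneg _)

lemma norm_form_le (v w : V) : ‖S.form v w‖ ≤ ‖S.toPre v‖ * ‖S.toPre w‖ := by
  have h : ∀ v, 0 ≤ ‖S.toPre v‖ := fun v ↦ Real.sqrt_nonneg _
  refine abs_le_of_sq_le_sq' ?_ (mul_nonneg (h v) (h w)) |>.2
  rw [mul_pow, pre_norm_sq, pre_norm_sq]
  exact S.cauchy_schwarz v w

lemma preCore : SeminormedSpace.Core ℂ S.Pre where
  norm_nonneg v := Real.sqrt_nonneg _
  norm_smul c v := by
    have h : ∀ v : S.Pre, 0 ≤ ‖v‖ := fun v ↦ Real.sqrt_nonneg _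
    rw [← sq_eq_sq₀ (h _) (mul_nonneg (norm_nonneg _) (h _)), mul_pow]
    change ‖c • v‖ ^ 2 = ‖c‖ ^ 2 * ‖v‖ ^ 2
    rw [pre_norm_sq, pre_norm_sq]
    simp [norm_smul, sq, mul_assoc]
  norm_triangle v w := by
    have h : ∀ v : S.Pre, 0 ≤ ‖v‖ := fun v ↦ Real.sqrt_nonneg _
    refine abs_le_of_sq_le_sq' ?_ (add_nonneg (h v) (h w)) |>.2
    have h₁ := S.norm_form_le (S.toPre.symm v) (S.toPre.symm w)
    have h₂ := S.norm_form_le (S.toPre.symm w) (S.toPre.symm v)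
    simp only [LinearEquiv.apply_symm_apply] at h₁ h₂
    rw [add_sq, pre_norm_sq, pre_norm_sq, pre_norm_sq]
    simp only [map_add, LinearMap.add_apply]
    refine (norm_add_le _ _).trans ?_
    have h₃ := norm_add_le (S.form (S.toPre.symm v) (S.toPre.symm v))
      (S.form (S.toPre.symm w) (S.toPre.symm v))
    have h₄ := norm_add_le (S.form (S.toPre.symm v) (S.toPre.symm w))
      (S.form (S.toPre.symm w) (S.toPre.symm w))
    nlinarith

instance : SeminormedAddCommGroup S.Pre := SeminormedAddCommGroup.ofCore S.preCore
instance : NormedSpace ℂ S.Pre where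
  norm_smul_le c v := (S.preCore.norm_smul c v).le

instance : Inner Bᵐᵒᵖ S.Pre := ⟨fun v w ↦ op (S.form (S.toPre.symm v) (S.toPre.symm w))⟩

/-- The Hilbert module obtained from a semi-inner product module: the completion of the quotient by
the vectors of length zero. (`UniformSpace.Completion` is the Hausdorff completion, so it includes
passing to the quotient.) -/
def Space : Type _ := UniformSpace.Completion S.Pre

instance : NormedAddCommGroup S.Space :=
  inferInstanceAs (NormedAddCommGroup (UniformSpace.Completion S.Pre))
instance : NormedSpace ℂ S.Space :=
  inferInstanceAs (NormedSpace ℂ (UniformSpace.Completion S.Pre))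
instance : CompleteSpace S.Space :=
  inferInstanceAs (CompleteSpace (UniformSpace.Completion S.Pre))
instance : Inner Bᵐᵒᵖ S.Space :=
  inferInstanceAs (Inner Bᵐᵒᵖ (UniformSpace.Completion S.Pre))

/-- The canonical map to the Hilbert module, with dense range. -/
def ι : V →ₗ[ℂ] S.Space :=
  (UniformSpace.Completion.toComplₗᵢ (𝕜 := ℂ) (E := S.Pre)).toLinearMap ∘ₗ S.toPre.toLinearMap

lemma ι_apply (v : V) : S.ι v = ((S.toPre v : S.Pre) : UniformSpace.Completion S.Pre) := rfl

lemma denseRange_ι : DenseRange S.ι := UniformSpace.Completion.denseRange_coe (α := S.Pre)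

lemma norm_ι (v : V) : ‖S.ι v‖ = ‖S.toPre v‖ := UniformSpace.Completion.norm_coe (S.toPre v)

lemma norm_ι_sq (v : V) : ‖S.ι v‖ ^ 2 = ‖S.form v v‖ := by
  rw [norm_ι, pre_norm_sq, LinearEquiv.symm_apply_apply]

/-- The bounded extension of a linear map to the completion. -/
def lift {Y : Type*} [NormedAddCommGroup Y] [NormedSpace ℂ Y] [CompleteSpace Y] (f : V →ₗ[ℂ] Y)
    (C : ℝ) (h : ∀ v, ‖f v‖ ≤ C * ‖S.ι v‖) : S.Space →L[ℂ] Y :=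
  ContinuousLinearMap.fromCompletion
    (LinearMap.mkContinuous (f ∘ₗ S.toPre.symm.toLinearMap) C fun v ↦ by
      simpa [norm_ι] using h (S.toPre.symm v))

@[simp] lemma lift_ι {Y : Type*} [NormedAddCommGroup Y] [NormedSpace ℂ Y] [CompleteSpace Y]
    (f : V →ₗ[ℂ] Y) (C : ℝ) (h : ∀ v, ‖f v‖ ≤ C * ‖S.ι v‖) (v : V) : S.lift f C h (S.ι v) = f v :=
  ContinuousLinearMap.fromCompletion_apply_coe _ _

lemma norm_act_le (b : B) (v : V) : ‖S.ι (S.act b v)‖ ≤ ‖b‖ * ‖S.ι v‖ := by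
  refine abs_le_of_sq_le_sq' ?_ (by positivity) |>.2
  rw [mul_pow, norm_ι_sq, norm_ι_sq, form_act, form_act_left]
  calc _ ≤ ‖star b‖ * ‖S.form v v‖ * ‖b‖ := by
        refine (norm_mul_le _ _).trans ?_
        gcongr
        exact norm_mul_le _ _
    _ = _ := by rw [norm_star]; ring

instance : SMul Bᵐᵒᵖ S.Space :=
  ⟨fun b ↦ S.lift (S.ι ∘ₗ S.act b.unop) ‖b.unop‖ (S.norm_act_le b.unop)⟩

lemma smul_ι (b : B) (v : V) : op b • S.ι v = S.ι (S.act b v) :=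
  S.lift_ι _ _ (S.norm_act_le b) v

lemma continuous_smul (b : Bᵐᵒᵖ) : Continuous fun z : S.Space ↦ b • z :=
  (S.lift (S.ι ∘ₗ S.act b.unop) ‖b.unop‖ (S.norm_act_le b.unop)).continuous

lemma continuous_pre_inner :
    Continuous fun p : S.Pre × S.Pre ↦ inner Bᵐᵒᵖ p.1 p.2 := by
  let g : S.Pre →L⋆[ℂ] S.Pre →L[ℂ] B :=
    LinearMap.mkContinuous₂ (E := S.Pre) (F := S.Pre) S.form 1 fun v w ↦ by
      rw [one_mul]
      exact S.norm_form_le v w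
  have : Continuous fun p : S.Pre × S.Pre ↦ g p.1 p.2 := by fun_prop
  exact continuous_op.comp this

lemma inner_ι (v w : V) : inner Bᵐᵒᵖ (S.ι v) (S.ι w) = op (S.form v w) :=
  (UniformSpace.Completion.isDenseInducing_coe.prodMap
    UniformSpace.Completion.isDenseInducing_coe).extend_eq S.continuous_pre_inner
    (S.toPre v, S.toPre w)

lemma continuous_inner : Continuous fun p : S.Space × S.Space ↦ inner Bᵐᵒᵖ p.1 p.2 := by
  let g : S.Pre →+ S.Pre →+ Bᵐᵒᵖ :=
    { toFun := fun v ↦ (opAddEquiv.toAddMonoidHom.comp (S.form v).toAddMonoidHom)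
      map_zero' := AddMonoidHom.ext fun w ↦ by
        exact congrArg op (S.form.map_zero₂ w)
      map_add' := fun v v' ↦ AddMonoidHom.ext fun w ↦ by
        exact congrArg op (S.form.map_add₂ v v' w) }
  have h : Continuous fun p : S.Pre × S.Pre ↦ g p.1 p.2 := S.continuous_pre_inner
  exact (UniformSpace.Completion.isDenseInducing_toCompl S.Pre).extend_Z_bilin
    (UniformSpace.Completion.isDenseInducing_toCompl S.Pre) h

lemma continuous_inner_comp {α : Type*} [TopologicalSpace α] {f g : α → S.Space}
    (hf : Continuous f) (hg : Continuous g) : Continuous fun a ↦ inner Bᵐᵒᵖ (f a) (g a) :=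
  S.continuous_inner.comp (hf.prodMk hg)

lemma ind₁ {p : S.Space → Prop} (hp : IsClosed {z | p z}) (h : ∀ v, p (S.ι v)) (z : S.Space) :
    p z := UniformSpace.Completion.induction_on (α := S.Pre) z hp h

lemma ind₂ {p : S.Space → S.Space → Prop} (hp : IsClosed {z : S.Space × S.Space | p z.1 z.2})
    (h : ∀ v w, p (S.ι v) (S.ι w)) (z z' : S.Space) : p z z' :=
  UniformSpace.Completion.induction_on₂ (α := S.Pre) (β := S.Pre) z z' hp h

lemma ind₃ {p : S.Space → S.Space → S.Space → Prop}
    (hp : IsClosed {z : S.Space × S.Space × S.Space | p z.1 z.2.1 z.2.2})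
    (h : ∀ u v w, p (S.ι u) (S.ι v) (S.ι w)) (z z' z'' : S.Space) : p z z' z'' :=
  UniformSpace.Completion.induction_on₃ (α := S.Pre) (β := S.Pre) (γ := S.Pre) z z' z'' hp h

lemma norm_sq_eq (z : S.Space) : ‖z‖ ^ 2 = ‖inner Bᵐᵒᵖ z z‖ := by
  refine S.ind₁ (p := fun z ↦ ‖z‖ ^ 2 = ‖inner Bᵐᵒᵖ z z‖) ?_ (fun v ↦ ?_) z
  · exact isClosed_eq (by fun_prop) (S.continuous_inner_comp continuous_id continuous_id).norm
  · rw [norm_ι_sq, inner_ι, norm_op]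

instance : CStarModule Bᵐᵒᵖ S.Space where
  inner_add_right {x y z} := by
    refine S.ind₃ (p := fun x y z ↦ inner Bᵐᵒᵖ x (y + z) = inner Bᵐᵒᵖ x y + inner Bᵐᵒᵖ x z)
      ?_ (fun u v w ↦ ?_) x y z
    · exact isClosed_eq (S.continuous_inner_comp continuous_fst
          ((continuous_fst.comp continuous_snd).add (continuous_snd.comp continuous_snd)))
        ((S.continuous_inner_comp continuous_fst (continuous_fst.comp continuous_snd)).add
          (S.continuous_inner_comp continuous_fst (continuous_snd.comp continuous_snd)))
    · rw [← map_add, inner_ι, inner_ι, inner_ι, map_add, op_add]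
  inner_self_nonneg {x} := by
    refine S.ind₁ (p := fun x ↦ 0 ≤ inner Bᵐᵒᵖ x x) ?_ (fun u ↦ ?_) x
    · exact (CStarAlgebra.isClosed_nonneg (A := B)).preimage (continuous_unop.comp
        (S.continuous_inner_comp continuous_id continuous_id))
    · rw [inner_ι]
      exact S.form_self_nonneg u
  inner_self {x} := by
    rw [← norm_eq_zero, ← norm_sq_eq, sq_eq_zero_iff, norm_eq_zero]
  inner_op_smul_right {b x y} := by
    refine S.ind₂ (p := fun x y ↦ inner Bᵐᵒᵖ x (b • y) = b * inner Bᵐᵒᵖ x y) ?_ (fun u v ↦ ?_) x y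
    · exact isClosed_eq (S.continuous_inner_comp continuous_fst
        ((S.continuous_smul b).comp continuous_snd))
        (continuous_const.mul (S.continuous_inner_comp continuous_fst continuous_snd))
    · obtain ⟨b, rfl⟩ := op_surjective b
      rw [smul_ι, inner_ι, inner_ι, form_act, op_mul]
  inner_smul_right_complex {c x y} := by
    refine S.ind₂ (p := fun x y ↦ inner Bᵐᵒᵖ x (c • y) = c • inner Bᵐᵒᵖ x y) ?_ (fun u v ↦ ?_) x y
    · exact isClosed_eq (S.continuous_inner_comp continuous_fst (continuous_snd.const_smul c))
        ((S.continuous_inner_comp continuous_fst continuous_snd).const_smul c)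
    · rw [← map_smul, inner_ι, inner_ι, map_smul, op_smul]
  star_inner x y := by
    refine S.ind₂ (p := fun x y ↦ star (inner Bᵐᵒᵖ x y) = inner Bᵐᵒᵖ y x) ?_ (fun u v ↦ ?_) x y
    · exact isClosed_eq (S.continuous_inner_comp continuous_fst continuous_snd).star
        (S.continuous_inner_comp continuous_snd continuous_fst)
    · rw [inner_ι, inner_ι, ← op_star, S.star_form]
  norm_eq_sqrt_norm_inner_self x := by
    rw [← norm_sq_eq, Real.sqrt_sq (norm_nonneg _)]

@[simp] lemma rip_ι (v w : V) : rip B (S.ι v) (S.ι w) = S.form v w := by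
  rw [rip, inner_ι, unop_op]

end SemiInner

end SemiInner

section Positivity

variable {A : Type*} [NonUnitalCStarAlgebra A] [PartialOrder A] [StarOrderedRing A]

lemma exists_sub_of_isSelfAdjoint {M : A} (hM : IsSelfAdjoint M) :
    ∃ P N : A, 0 ≤ P ∧ 0 ≤ N ∧ N * P = 0 ∧ M = P - N :=
  ⟨M⁺, M⁻, CFC.posPart_nonneg M, CFC.negPart_nonneg M, CFC.negPart_mul_posPart M,
    (CFC.posPart_sub_negPart M hM).symm⟩

lemma exists_eq_star_mul_self {M : A} (hM : 0 ≤ M) : ∃ R : A, M = star R * R :=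
  CStarAlgebra.nonneg_iff_eq_star_mul_self.1 hM

/-- A matrix over a C⋆-algebra whose quadratic form is positive is positive. -/
lemma cstarMatrix_nonneg_of_form_nonneg {n : ℕ} (M : CStarMatrix (Fin n) (Fin n) A)
    (hM : IsSelfAdjoint M)
    (h : ∀ v : Fin n → A, 0 ≤ ∑ i, ∑ j, star (v i) * M i j * v j) : 0 ≤ M := by
  obtain ⟨P, N, hP0, hN0, hNP, hMPN⟩ := exists_sub_of_isSelfAdjoint hM
  have hNs : star N = N := (IsSelfAdjoint.of_nonneg hN0).star_eq
  have hNM : N * M * N = -(star N * N * N) := by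
    rw [hMPN, mul_sub, hNP, hNs, zero_sub, neg_mul]
  have hN3 : 0 ≤ star N * N * N := star_left_conjugate_nonneg hN0 N
  obtain ⟨R, hR⟩ := exists_eq_star_mul_self hN3
  have hdiag : ∀ k, (N * M * N) k k = ∑ i, ∑ j, star (N i k) * M i j * N j k := fun k ↦ by
    have hs : ∀ i, star (N i k) = N k i := fun i ↦ by
      conv_rhs => rw [← hNs]
      rfl
    simp only [CStarMatrix.mul_apply, hs, Finset.sum_mul]
    exact Finset.sum_comm
  have hR0 : R = 0 := by
    ext i k
    have h₁ : 0 ≤ -∑ i, star (R i k) * R i k := by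
      have := h fun i ↦ N i k
      rw [← hdiag, hNM, hR] at this
      exact this
    have h₂ : ∑ i, star (R i k) * R i k = 0 :=
      le_antisymm (neg_nonneg.1 h₁) (Finset.sum_nonneg fun i _ ↦ star_mul_self_nonneg _)
    rw [Finset.sum_eq_zero_iff_of_nonneg fun i _ ↦ star_mul_self_nonneg _] at h₂
    exact (CStarRing.star_mul_self_eq_zero_iff _).1 (h₂ i (Finset.mem_univ i))
  have hNN : star (star N * N) * (star N * N) = 0 := by
    rw [hR0, mul_zero, hNs] at hR
    rw [star_mul, star_star, hNs, ← mul_assoc, hR, zero_mul]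
  have hN1 : N = 0 := by
    rwa [CStarRing.star_mul_self_eq_zero_iff, CStarRing.star_mul_self_eq_zero_iff] at hNN
  rw [hMPN, hN1, sub_zero]
  exact hP0

/-- The Gram matrix of finitely many vectors of a Hilbert module is positive. -/
lemma gram_nonneg {E : Type*} [NormedAddCommGroup E] [NormedSpace ℂ E] [SMul Aᵐᵒᵖ E]
    [CStarModule Aᵐᵒᵖ E] {n : ℕ} (e : Fin n → E) :
    0 ≤ CStarMatrix.ofMatrix (Matrix.of fun i j ↦ rip A (e i) (e j)) := by
  refine cstarMatrix_nonneg_of_form_nonneg _ ?_ fun v ↦ ?_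
  · ext i j
    exact star_rip (e j) (e i)
  · have := rip_self_nonneg (B := A) (∑ i, op (v i) • e i)
    simp only [rip_sum_right, rip_sum_left, rip_act_left, rip_act_right] at this
    simp only [Finset.sum_mul] at this
    rw [Finset.sum_comm] at this
    exact this

lemma adj_matrix_form_nonneg {X : Type*} [NormedAddCommGroup X] [NormedSpace ℂ X] [SMul Aᵐᵒᵖ X]
    [CStarModule Aᵐᵒᵖ X] [CompleteSpace X] {n : ℕ} (M : CStarMatrix (Fin n) (Fin n) (Adj A X))
    (hM : 0 ≤ M) (x : Fin n → X) : 0 ≤ ∑ i, ∑ j, rip A (x i) (M i j (x j)) := by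
  obtain ⟨R, rfl⟩ := exists_eq_star_mul_self hM
  have h : ∀ i j, rip A (x i) ((star R * R) i j (x j)) =
      ∑ k, rip A (R k i (x i)) (R k j (x j)) := fun i j ↦ by
    have : ∀ s : Finset (Fin n), (∑ k ∈ s, star (R k i) * R k j) (x j) =
        ∑ k ∈ s, star (R k i) (R k j (x j)) := fun s ↦ by
      induction s using Finset.cons_induction with
      | empty => simp
      | cons a s ha ih => rw [Finset.sum_cons, Finset.sum_cons, Adj.add_apply, ih, Adj.mul_apply]
    rw [CStarMatrix.mul_apply]
    change rip A (x i) ((∑ k, star (R k i) * R k j) (x j)) = _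
    simp only [this, rip_sum_right, Adj.rip_star_right]
  have : ∑ i, ∑ j, rip A (x i) ((star R * R) i j (x j)) =
      ∑ k, rip A (∑ i, R k i (x i)) (∑ i, R k i (x i)) := by
    simp only [h, rip_sum_right, rip_sum_left]
    calc _ = ∑ i, ∑ k, ∑ j, rip A (R k i (x i)) (R k j (x j)) :=
          Finset.sum_congr rfl fun i _ ↦ Finset.sum_comm
      _ = ∑ k, ∑ i, ∑ j, rip A (R k i (x i)) (R k j (x j)) := Finset.sum_comm
      _ = _ := Finset.sum_congr rfl fun k _ ↦ Finset.sum_comm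
  rw [this]
  exact Finset.sum_nonneg fun k _ ↦ rip_self_nonneg _

end Positivity

section Tensor

variable {A B E X : Type*}
  [NonUnitalCStarAlgebra A] [PartialOrder A] [StarOrderedRing A]
  [NonUnitalCStarAlgebra B] [PartialOrder B] [StarOrderedRing B]
  [NormedAddCommGroup E] [NormedSpace ℂ E] [SMul Aᵐᵒᵖ E] [CStarModule Aᵐᵒᵖ E]
  [NormedAddCommGroup X] [NormedSpace ℂ X] [SMul Bᵐᵒᵖ X] [CStarModule Bᵐᵒᵖ X] [CompleteSpace X]

variable (X) in
/-- Right multiplication `x ↦ x b` on a right Hilbert module, as a linear map. -/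
def actLin (b : B) : X →ₗ[ℂ] X where
  toFun x := op b • x
  map_add' x y := rip_ext_right (B := B) fun z ↦ by
    simp only [rip_add_right, rip_act_right, add_mul]
  map_smul' c x := rip_ext_right (B := B) fun z ↦ by
    simp only [rip_smul_right, rip_act_right, smul_mul_assoc, RingHom.id_apply]

variable (E) in
/-- The form `⟨e ⊗ x, e' ⊗ x'⟩ = ⟨x, ρ(⟨e, e'⟩) x'⟩` on the algebraic tensor product. -/
def cpSesq (ρ : A →CP Adj B X) : E ⊗[ℂ] X →ₗ⋆[ℂ] E ⊗[ℂ] X →ₗ[ℂ] B :=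
  TensorProduct.lift <| LinearMap.mk₂'ₛₗ (starRingEnd ℂ) (starRingEnd ℂ)
    (fun e x ↦ TensorProduct.lift <| LinearMap.mk₂ ℂ
      (fun e' x' ↦ rip B x (ρ (rip A e e') x'))
      (fun e₁ e₂ x' ↦ by rw [rip_add_right, map_add, Adj.add_apply, rip_add_right])
      (fun c e' x' ↦ by rw [rip_smul_right, map_smul, Adj.smul_apply, rip_smul_right])
      (fun e' x₁ x₂ ↦ by rw [map_add, rip_add_right])
      (fun c e' x' ↦ by rw [map_smul, rip_smul_right]))
    (fun e₁ e₂ x ↦ TensorProduct.ext' fun e' x' ↦ by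
      simp only [TensorProduct.lift.tmul, LinearMap.mk₂_apply, LinearMap.add_apply,
        rip_add_left, map_add, Adj.add_apply, rip_add_right])
    (fun c e x ↦ TensorProduct.ext' fun e' x' ↦ by
      simp only [TensorProduct.lift.tmul, LinearMap.mk₂_apply, LinearMap.smul_apply,
        rip_smul_left, map_smul, Adj.smul_apply, rip_smul_right, starRingEnd_apply])
    (fun e x₁ x₂ ↦ TensorProduct.ext' fun e' x' ↦ by
      simp only [TensorProduct.lift.tmul, LinearMap.mk₂_apply, LinearMap.add_apply, rip_add_left])
    (fun c e x ↦ TensorProduct.ext' fun e' x' ↦ by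
      simp only [TensorProduct.lift.tmul, LinearMap.mk₂_apply, LinearMap.smul_apply,
        rip_smul_left, starRingEnd_apply])

@[simp] lemma cpSesq_tmul (ρ : A →CP Adj B X) (e e' : E) (x x' : X) :
    cpSesq E ρ (e ⊗ₜ x) (e' ⊗ₜ x') = rip B x (ρ (rip A e e') x') := rfl

lemma map_star_of_cp (ρ : A →CP Adj B X) (a : A) : ρ (star a) = star (ρ a) := map_star ρ a

variable (E) in
/-- The semi-inner product module underlying the tensor product of a right Hilbert `A`-module `E`
and a right Hilbert `B`-module `X` over a completely positive map `ρ : A → End_B(X)`. -/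
def cpForm (ρ : A →CP Adj B X) : SemiInner B (E ⊗[ℂ] X) where
  form := cpSesq E ρ
  act b := (actLin X b).lTensor E
  form_act b v w := by
    induction w with
    | zero => simp
    | add w₁ w₂ h₁ h₂ => simp only [map_add, h₁, h₂, add_mul]
    | tmul e' x' =>
      induction v with
      | zero => simp
      | add v₁ v₂ h₁ h₂ => simp only [map_add, LinearMap.add_apply, h₁, h₂, add_mul]
      | tmul e x =>
        rw [LinearMap.lTensor_tmul, cpSesq_tmul, cpSesq_tmul]
        rw [← Adj.rip_star_left, ← Adj.rip_star_left]
        exact rip_act_right _ _ _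
  star_form v w := by
    induction w with
    | zero => simp
    | add w₁ w₂ h₁ h₂ => simp only [map_add, LinearMap.add_apply, h₁, h₂, star_add]
    | tmul e' x' =>
      induction v with
      | zero => simp
      | add v₁ v₂ h₁ h₂ => simp only [map_add, LinearMap.add_apply, h₁, h₂, star_add]
      | tmul e x =>
        rw [cpSesq_tmul, cpSesq_tmul, star_rip, ← Adj.rip_star_right, ← map_star_of_cp, star_rip]
  form_self_nonneg v := by
    obtain ⟨n, e, x, rfl⟩ := TensorProduct.exists_sum_tmul_eq v
    simp only [map_sum, LinearMap.sum_apply, cpSesq_tmul]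
    rw [Finset.sum_comm]
    exact adj_matrix_form_nonneg _ (ρ.map_cstarMatrix_nonneg _ (gram_nonneg e)) x

variable (E) in
/-- The tensor product `E ⊗_ρ X` of a right Hilbert `A`-module `E` and a right Hilbert `B`-module
`X` over a completely positive map `ρ : A → End_B(X)`: the completion of the quotient of the
algebraic tensor product by the vectors of length zero, with
`⟨e ⊗ x, e' ⊗ x'⟩ = ⟨x, ρ(⟨e, e'⟩) x'⟩`. For `E = A` this is the KSGNS module of `ρ`, and if
`ρ` is a `*`-homomorphism it is the internal tensor product. -/
abbrev CPTensor (ρ : A →CP Adj B X) : Type _ := (cpForm E ρ).Space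

variable [CompleteSpace E]

variable (X) in
/-- The operator `T ⊗ 1` on the algebraic tensor product. -/
def ampLin (T : Adj A E) : E ⊗[ℂ] X →ₗ[ℂ] E ⊗[ℂ] X := T.toCLM.toLinearMap.rTensor X

@[simp] lemma ampLin_tmul (T : Adj A E) (e : E) (x : X) : ampLin X T (e ⊗ₜ x) = T e ⊗ₜ x := rfl

lemma ampLin_mul (S T : Adj A E) (v : E ⊗[ℂ] X) :
    ampLin X (S * T) v = ampLin X S (ampLin X T v) :=
  LinearMap.rTensor_comp_apply X S.toCLM.toLinearMap T.toCLM.toLinearMap v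

lemma ampLin_add (S T : Adj A E) (v : E ⊗[ℂ] X) :
    ampLin X (S + T) v = ampLin X S v + ampLin X T v :=
  congrArg (fun f ↦ f v) (LinearMap.rTensor_add X S.toCLM.toLinearMap T.toCLM.toLinearMap)

lemma ampLin_sub (S T : Adj A E) (v : E ⊗[ℂ] X) :
    ampLin X (S - T) v = ampLin X S v - ampLin X T v :=
  congrArg (fun f : E ⊗[ℂ] X →ₗ[ℂ] E ⊗[ℂ] X ↦ f v)
    (LinearMap.rTensor_sub S.toCLM.toLinearMap T.toCLM.toLinearMap)

lemma ampLin_smul (c : ℂ) (T : Adj A E) (v : E ⊗[ℂ] X) :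
    ampLin X (c • T) v = c • ampLin X T v :=
  congrArg (fun f ↦ f v) (LinearMap.rTensor_smul X c T.toCLM.toLinearMap)

lemma ampLin_one (v : E ⊗[ℂ] X) : ampLin X (1 : Adj A E) v = v :=
  LinearMap.rTensor_id_apply X E v

lemma cpForm_ampLin (ρ : A →CP Adj B X) (T : Adj A E) (v w : E ⊗[ℂ] X) :
    (cpForm E ρ).form (ampLin X T v) w = (cpForm E ρ).form v (ampLin X (star T) w) := by
  change cpSesq E ρ _ _ = cpSesq E ρ _ _
  induction w with
  | zero => simp
  | add w₁ w₂ h₁ h₂ => simp only [map_add, h₁, h₂]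
  | tmul e' x' =>
    induction v with
    | zero => simp
    | add v₁ v₂ h₁ h₂ => simp only [map_add, LinearMap.add_apply, h₁, h₂]
    | tmul e x =>
      rw [ampLin_tmul, ampLin_tmul, cpSesq_tmul, cpSesq_tmul, Adj.rip_star_right]

lemma cpForm_nonneg_of_nonneg (ρ : A →CP Adj B X) {T : Adj A E} (hT : 0 ≤ T) (v : E ⊗[ℂ] X) :
    0 ≤ (cpForm E ρ).form v (ampLin X T v) := by
  obtain ⟨R, rfl⟩ := exists_eq_star_mul_self hT
  rw [ampLin_mul, ← cpForm_ampLin]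
  exact (cpForm E ρ).form_self_nonneg _

lemma cpForm_norm_le (ρ : A →CP Adj B X) (T : Adj A E) (v : E ⊗[ℂ] X) :
    ‖((cpForm E ρ).ι ∘ₗ ampLin X T) v‖ ≤ ‖T‖ * ‖(cpForm E ρ).ι v‖ := by
  refine abs_le_of_sq_le_sq' ?_ (by positivity) |>.2
  rw [LinearMap.comp_apply, mul_pow, SemiInner.norm_ι_sq, SemiInner.norm_ι_sq]
  have h₁ : 0 ≤ ((‖T‖ ^ 2 : ℝ) : ℂ) • (1 : Adj A E) - star T * T := by
    rw [sub_nonneg]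
    have := CStarAlgebra.star_mul_le_algebraMap_norm_sq (a := T)
    rwa [Algebra.algebraMap_eq_smul_one, ← Complex.coe_smul] at this
  have h₂ := cpForm_nonneg_of_nonneg ρ h₁ v
  rw [ampLin_sub, ampLin_smul, ampLin_one, ampLin_mul, map_sub, map_smul, ← cpForm_ampLin,
    sub_nonneg, Complex.coe_smul] at h₂
  refine (CStarAlgebra.norm_le_norm_of_nonneg_of_le
    ((cpForm E ρ).form_self_nonneg _) h₂).trans_eq ?_
  rw [norm_smul, Real.norm_of_nonneg (by positivity)]

/-- The extension of `T ⊗ 1` to `E ⊗_ρ X`. -/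
def ampCLM (ρ : A →CP Adj B X) (T : Adj A E) : CPTensor E ρ →L[ℂ] CPTensor E ρ :=
  (cpForm E ρ).lift ((cpForm E ρ).ι ∘ₗ ampLin X T) ‖T‖ (cpForm_norm_le ρ T)

@[simp] lemma ampCLM_ι (ρ : A →CP Adj B X) (T : Adj A E) (v : E ⊗[ℂ] X) :
    ampCLM ρ T ((cpForm E ρ).ι v) = (cpForm E ρ).ι (ampLin X T v) :=
  SemiInner.lift_ι ..

lemma ampCLM_ext {ρ : A →CP Adj B X} {f g : CPTensor E ρ → CPTensor E ρ} (hf : Continuous f)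
    (hg : Continuous g) (h : ∀ v, f ((cpForm E ρ).ι v) = g ((cpForm E ρ).ι v)) (z : CPTensor E ρ) :
    f z = g z :=
  (cpForm E ρ).ind₁ (p := fun z ↦ f z = g z) (isClosed_eq hf hg) h z

lemma rip_ampCLM (ρ : A →CP Adj B X) (T : Adj A E) (z w : CPTensor E ρ) :
    rip B (ampCLM ρ T z) w = rip B z (ampCLM ρ (star T) w) := by
  refine (cpForm E ρ).ind₂
    (p := fun z w ↦ rip B (ampCLM ρ T z) w = rip B z (ampCLM ρ (star T) w)) ?_ ?_ z w
  · exact isClosed_eq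
      (continuous_rip_comp ((ampCLM ρ T).continuous.comp continuous_fst) continuous_snd)
      (continuous_rip_comp continuous_fst ((ampCLM ρ (star T)).continuous.comp continuous_snd))
  · intro v w
    rw [ampCLM_ι, ampCLM_ι, SemiInner.rip_ι, SemiInner.rip_ι, cpForm_ampLin]

/-- The `*`-homomorphism `End_A(E) → End_B(E ⊗_ρ X)`, `T ↦ T ⊗ 1`. -/
def amp (ρ : A →CP Adj B X) : Adj A E →⋆ₐ[ℂ] Adj B (CPTensor E ρ) where
  toFun T := Adj.mk (ampCLM ρ T) (ampCLM ρ (star T)) (rip_ampCLM ρ T)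
  map_one' := Adj.ext fun z ↦ ampCLM_ext (ampCLM ρ 1).continuous continuous_id
    (fun v ↦ by rw [ampCLM_ι, ampLin_one, id]) z
  map_mul' S T := Adj.ext fun z ↦ ampCLM_ext (ampCLM ρ (S * T)).continuous
    ((ampCLM ρ S).continuous.comp (ampCLM ρ T).continuous)
    (fun v ↦ by simp only [Function.comp_apply, ampCLM_ι, ampLin_mul]) z
  map_zero' := Adj.ext fun z ↦ ampCLM_ext (ampCLM ρ 0).continuous continuous_const
    (fun v ↦ by
      have : ampLin X (0 : Adj A E) v = 0 := by
        have := ampLin_smul (0 : ℂ) (0 : Adj A E) v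
        rwa [zero_smul, zero_smul] at this
      rw [ampCLM_ι, this, map_zero]
      rfl) z
  map_add' S T := Adj.ext fun z ↦ ampCLM_ext (ampCLM ρ (S + T)).continuous
    ((ampCLM ρ S).continuous.add (ampCLM ρ T).continuous)
    (fun v ↦ by simp only [ampCLM_ι, ampLin_add, map_add, Pi.add_apply]) z
  commutes' c := Adj.ext fun z ↦ ampCLM_ext (ampCLM ρ (algebraMap ℂ _ c)).continuous
    (continuous_const_smul c)
    (fun v ↦ by
      rw [ampCLM_ι, Algebra.algebraMap_eq_smul_one, ampLin_smul, ampLin_one, map_smul]) z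
  map_star' T := Adj.ext fun z ↦ rip_ext_right (B := B) fun w ↦ by
    rw [Adj.rip_star_right]
    exact (rip_ampCLM ρ T w z).symm

@[simp] lemma amp_ι (ρ : A →CP Adj B X) (T : Adj A E) (v : E ⊗[ℂ] X) :
    amp ρ T ((cpForm E ρ).ι v) = (cpForm E ρ).ι (ampLin X T v) :=
  ampCLM_ι ρ T v

end Tensor

section Self

variable {A : Type*} [NonUnitalCStarAlgebra A] [PartialOrder A] [StarOrderedRing A]

/-- The trivial right Hilbert module `A_A`, with `⟨x, y⟩ = x* y`. -/
instance selfModule : CStarModule Aᵐᵒᵖ A where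
  inner x y := op (star x * y)
  inner_add_right := by simp [mul_add]
  inner_self_nonneg {x} := star_mul_self_nonneg x
  inner_self {x} := by simp
  inner_op_smul_right {a x y} := by
    obtain ⟨a, rfl⟩ := op_surjective a
    simp [← op_mul, mul_assoc]
  inner_smul_right_complex {c x y} := by rw [mul_smul_comm, op_smul]
  star_inner x y := by simp [← op_star]
  norm_eq_sqrt_norm_inner_self x := by
    rw [norm_op, CStarRing.norm_star_mul_self, Real.sqrt_mul_self (norm_nonneg _)]

variable (A) in
/-- The action of `A` on `A_A` by left multiplication. -/
def leftMul : A →⋆ₙₐ[ℂ] Adj A A where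
  toFun a := Adj.mk (ContinuousLinearMap.mul ℂ A a) (ContinuousLinearMap.mul ℂ A (star a))
    fun x y ↦ by simp [rip, inner, mul_assoc]
  map_smul' c a := Adj.ext fun x ↦ by simp
  map_zero' := Adj.ext fun x ↦ by simp
  map_add' a b := Adj.ext fun x ↦ by simp
  map_mul' a b := Adj.ext fun x ↦ by simp [mul_assoc]
  map_star' a := Adj.ext fun x ↦ rip_ext_right (B := A) fun w ↦ by
    rw [Adj.rip_star_right]
    simp [rip, inner, mul_assoc]

@[simp] lemma leftMul_apply (a x : A) : leftMul A a x = a * x := rfl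

end Self

section Unitary

variable (B X Y : Type*) [NonUnitalCStarAlgebra B] [PartialOrder B] [StarOrderedRing B]
  [NormedAddCommGroup X] [NormedSpace ℂ X] [SMul Bᵐᵒᵖ X] [CStarModule Bᵐᵒᵖ X]
  [NormedAddCommGroup Y] [NormedSpace ℂ Y] [SMul Bᵐᵒᵖ Y] [CStarModule Bᵐᵒᵖ Y]

/-- An adjointable unitary map `U : X → Y` of right Hilbert `B`-modules: a bounded operator with
an adjoint `U*` such that `U* U = 1` and `U U* = 1`. -/
structure AdjUnitary where
  toCLM : X →L[ℂ] Y
  adj : Y →L[ℂ] X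
  rip_adj : ∀ x y, rip B (toCLM x) y = rip B x (adj y)
  adj_toCLM : ∀ x, adj (toCLM x) = x
  toCLM_adj : ∀ y, toCLM (adj y) = y

namespace AdjUnitary

variable {B X Y}

/-- The identity. -/
def refl : AdjUnitary B X X where
  toCLM := .id ℂ X
  adj := .id ℂ X
  rip_adj _ _ := rfl
  adj_toCLM _ := rfl
  toCLM_adj _ := rfl

/-- The inverse. -/
def symm (U : AdjUnitary B X Y) : AdjUnitary B Y X where
  toCLM := U.adj
  adj := U.toCLM
  rip_adj x y := by rw [← star_rip, ← U.rip_adj, star_rip]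
  adj_toCLM := U.toCLM_adj
  toCLM_adj := U.adj_toCLM

/-- The composition. -/
def trans {Z : Type*} [NormedAddCommGroup Z] [NormedSpace ℂ Z] [SMul Bᵐᵒᵖ Z] [CStarModule Bᵐᵒᵖ Z]
    (U : AdjUnitary B X Y) (V : AdjUnitary B Y Z) : AdjUnitary B X Z where
  toCLM := V.toCLM ∘L U.toCLM
  adj := U.adj ∘L V.adj
  rip_adj x y := by simp [V.rip_adj, U.rip_adj]
  adj_toCLM x := by simp [V.adj_toCLM, U.adj_toCLM]
  toCLM_adj x := by simp [V.toCLM_adj, U.toCLM_adj]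

lemma rip_toCLM (U : AdjUnitary B X Y) (x y : X) :
    rip B (U.toCLM x) (U.toCLM y) = rip B x y := by
  rw [U.rip_adj, U.adj_toCLM]

end AdjUnitary

variable {B}

lemma SemiInner.norm_ι_comp_le {V W : Type*} [AddCommGroup V] [Module ℂ V] [AddCommGroup W]
    [Module ℂ W] (S : SemiInner B V) (T : SemiInner B W) (f : V →ₗ[ℂ] W)
    (h : ∀ v w, T.form (f v) (f w) = S.form v w) (v : V) : ‖(T.ι ∘ₗ f) v‖ ≤ 1 * ‖S.ι v‖ := by
  rw [one_mul, ← sq_le_sq₀ (norm_nonneg _) (norm_nonneg _)]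
  exact ((T.norm_ι_sq _).trans ((congrArg norm (h v v)).trans (S.norm_ι_sq v).symm)).le

/-- Mutually inverse form-preserving linear maps between semi-inner product modules induce a
unitary between the Hilbert modules. -/
def SemiInner.unitary {V W : Type*} [AddCommGroup V] [Module ℂ V] [AddCommGroup W] [Module ℂ W]
    (S : SemiInner B V) (T : SemiInner B W) (f : V ≃ₗ[ℂ] W)
    (h : ∀ v w, T.form (f v) (f w) = S.form v w) : AdjUnitary B S.Space T.Space :=
  have h₁ := S.norm_ι_comp_le T f.toLinearMap h
  have h' : ∀ v w, S.form (f.symm v) (f.symm w) = T.form v w := fun v w ↦ by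
    rw [← h, f.apply_symm_apply, f.apply_symm_apply]
  have h₂ := T.norm_ι_comp_le S f.symm.toLinearMap h'
  have hf : ∀ v, S.lift (T.ι ∘ₗ f.toLinearMap) 1 h₁ (S.ι v) = T.ι (f v) := S.lift_ι _ _ h₁
  have hg : ∀ v, T.lift (S.ι ∘ₗ f.symm.toLinearMap) 1 h₂ (T.ι v) = S.ι (f.symm v) :=
    T.lift_ι _ _ h₂
  { toCLM := S.lift (T.ι ∘ₗ f.toLinearMap) 1 h₁
    adj := T.lift (S.ι ∘ₗ f.symm.toLinearMap) 1 h₂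
    rip_adj := fun z w ↦ by
      revert w
      refine S.ind₁ (p := fun z ↦ ∀ w, rip B (S.lift (T.ι ∘ₗ f.toLinearMap) 1 h₁ z) w =
        rip B z (T.lift (S.ι ∘ₗ f.symm.toLinearMap) 1 h₂ w)) ?_ (fun v ↦ ?_) z
      · rw [Set.ofPred_forall]
        refine isClosed_iInter fun w ↦ ?_
        exact isClosed_eq (continuous_rip_comp (ContinuousLinearMap.continuous _) continuous_const)
          (continuous_rip_comp continuous_id continuous_const)
      · refine T.ind₁ ?_ fun w ↦ ?_
        · exact isClosed_eq (continuous_rip_comp continuous_const continuous_id)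
            (continuous_rip_comp continuous_const (ContinuousLinearMap.continuous _))
        · rw [hf, hg, T.rip_ι, S.rip_ι, ← h, f.apply_symm_apply]
    adj_toCLM := S.ind₁ (isClosed_eq ((ContinuousLinearMap.continuous _).comp
        (ContinuousLinearMap.continuous _)) continuous_id) fun v ↦ by
      rw [hf, hg, f.symm_apply_apply]
    toCLM_adj := T.ind₁ (isClosed_eq ((ContinuousLinearMap.continuous _).comp
        (ContinuousLinearMap.continuous _)) continuous_id) fun v ↦ by
      rw [hg, hf, f.apply_symm_apply] }

lemma SemiInner.unitary_ι {V W : Type*} [AddCommGroup V] [Module ℂ V] [AddCommGroup W]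
    [Module ℂ W] (S : SemiInner B V) (T : SemiInner B W) (f : V ≃ₗ[ℂ] W)
    (h : ∀ v w, T.form (f v) (f w) = S.form v w) (v : V) :
    (S.unitary T f h).toCLM (S.ι v) = T.ι (f v) :=
  S.lift_ι _ _ (S.norm_ι_comp_le T f.toLinearMap h) v

/-- The underlying linear equivalence of a unitary. -/
def AdjUnitary.toLinearEquiv {X Y} [NormedAddCommGroup X] [NormedSpace ℂ X] [SMul Bᵐᵒᵖ X]
    [CStarModule Bᵐᵒᵖ X] [NormedAddCommGroup Y] [NormedSpace ℂ Y] [SMul Bᵐᵒᵖ Y]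
    [CStarModule Bᵐᵒᵖ Y] (U : AdjUnitary B X Y) : X ≃ₗ[ℂ] Y :=
  LinearEquiv.ofLinearMap U.toCLM.toLinearMap U.adj.toLinearMap
    (LinearMap.ext U.toCLM_adj) (LinearMap.ext U.adj_toCLM)

section

variable {A E E' X X' : Type*}
  [NonUnitalCStarAlgebra A] [PartialOrder A] [StarOrderedRing A]
  [NormedAddCommGroup E] [NormedSpace ℂ E] [SMul Aᵐᵒᵖ E] [CStarModule Aᵐᵒᵖ E] [CompleteSpace E]
  [NormedAddCommGroup E'] [NormedSpace ℂ E'] [SMul Aᵐᵒᵖ E'] [CStarModule Aᵐᵒᵖ E'] [CompleteSpace E']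
  [NormedAddCommGroup X] [NormedSpace ℂ X] [SMul Bᵐᵒᵖ X] [CStarModule Bᵐᵒᵖ X] [CompleteSpace X]
  [NormedAddCommGroup X'] [NormedSpace ℂ X'] [SMul Bᵐᵒᵖ X'] [CStarModule Bᵐᵒᵖ X']
  [CompleteSpace X']

/-- Unitaries `E ≅ E'` and `X ≅ X'`, the latter intertwining `ρ` and `ρ'`, induce a unitary
`E ⊗_ρ X ≅ E' ⊗_ρ' X'`. -/
def tensorUnitary {ρ : A →CP Adj B X} {ρ' : A →CP Adj B X'} (U : AdjUnitary A E E')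
    (W : AdjUnitary B X X') (h : ∀ a x, W.toCLM (ρ a x) = ρ' a (W.toCLM x)) :
    AdjUnitary B (CPTensor E ρ) (CPTensor E' ρ') :=
  (cpForm E ρ).unitary (cpForm E' ρ') (TensorProduct.congr U.toLinearEquiv W.toLinearEquiv)
    fun v w ↦ by
      change cpSesq E' ρ' _ _ = cpSesq E ρ _ _
      induction w with
      | zero => simp
      | add w₁ w₂ h₁ h₂ => simp only [map_add, h₁, h₂]
      | tmul e' x' =>
        induction v with
        | zero => simp
        | add v₁ v₂ h₁ h₂ => simp only [map_add, LinearMap.add_apply, h₁, h₂]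
        | tmul e x =>
          change rip B (W.toCLM x) (ρ' (rip A (U.toCLM e) (U.toCLM e')) (W.toCLM x')) = _
          rw [U.rip_toCLM, ← h, W.rip_toCLM, cpSesq_tmul]

lemma tensorUnitary_amp {ρ : A →CP Adj B X} {ρ' : A →CP Adj B X'} (U : AdjUnitary A E E')
    (W : AdjUnitary B X X') (h : ∀ a x, W.toCLM (ρ a x) = ρ' a (W.toCLM x)) (T : Adj A E)
    (T' : Adj A E') (hT : ∀ e, U.toCLM (T e) = T' (U.toCLM e)) (z : CPTensor E ρ) :
    (tensorUnitary U W h).toCLM (amp ρ T z) = amp ρ' T' ((tensorUnitary U W h).toCLM z) := by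
  refine (cpForm E ρ).ind₁ (p := fun z ↦ (tensorUnitary U W h).toCLM (amp ρ T z) =
    amp ρ' T' ((tensorUnitary U W h).toCLM z)) ?_ (fun v ↦ ?_) z
  · exact isClosed_eq ((ContinuousLinearMap.continuous _).comp (amp ρ T).toCLM.continuous)
      ((amp ρ' T').toCLM.continuous.comp (ContinuousLinearMap.continuous _))
  · rw [amp_ι, tensorUnitary, SemiInner.unitary_ι, SemiInner.unitary_ι, amp_ι]
    congr 1
    induction v with
    | zero => simp
    | add v₁ v₂ h₁ h₂ => simp only [map_add, h₁, h₂]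
    | tmul e x =>
      change U.toCLM (T e) ⊗ₜ[ℂ] W.toCLM x = T' (U.toCLM e) ⊗ₜ[ℂ] W.toCLM x
      rw [hT]

end

end Unitary

section Strict

variable {A B X : Type*}
  [NonUnitalCStarAlgebra A] [PartialOrder A] [StarOrderedRing A]
  [NonUnitalCStarAlgebra B] [PartialOrder B] [StarOrderedRing B]
  [NormedAddCommGroup X] [NormedSpace ℂ X] [SMul Bᵐᵒᵖ X] [CStarModule Bᵐᵒᵖ X] [CompleteSpace X]

/-- A completely positive map `ρ : A → End_B(X)` is strict if `(ρ(aᵢ))ᵢ` is Cauchy in the strict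
(equivalently on bounded sets, strong-`*`) topology for some approximate unit `(aᵢ)ᵢ` of positive
contractions in `A`. The approximate unit is given by a filter on `A`. -/
def IsStrict (ρ : A →CP Adj B X) : Prop :=
  ∃ l : Filter A, l.IsIncreasingApproximateUnit ∧
    ∀ x : X, Cauchy (l.map fun a ↦ ρ a x) ∧ Cauchy (l.map fun a ↦ star (ρ a) x)

/-- A `*`-homomorphism as a completely positive map. -/
def homCP {D D' : Type*} [NonUnitalCStarAlgebra D] [PartialOrder D] [StarOrderedRing D]
    [NonUnitalCStarAlgebra D'] [PartialOrder D'] [StarOrderedRing D'] (π : D →⋆ₙₐ[ℂ] D') :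
    D →CP D' :=
  CompletelyPositiveMapClass.toCompletelyPositiveLinearMap π

@[simp] lemma homCP_apply {D D' : Type*} [NonUnitalCStarAlgebra D] [PartialOrder D]
    [StarOrderedRing D] [NonUnitalCStarAlgebra D'] [PartialOrder D'] [StarOrderedRing D']
    (π : D →⋆ₙₐ[ℂ] D') (d : D) : homCP π d = π d := rfl

/-- The composition of completely positive maps. -/
def compCP {D D' D'' : Type*} [NonUnitalCStarAlgebra D] [PartialOrder D] [StarOrderedRing D]
    [NonUnitalCStarAlgebra D'] [PartialOrder D'] [StarOrderedRing D']
    [NonUnitalCStarAlgebra D''] [PartialOrder D''] [StarOrderedRing D'']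
    (σ : D' →CP D'') (ρ : D →CP D') : D →CP D'' where
  toLinearMap := σ.toLinearMap ∘ₗ ρ.toLinearMap
  map_cstarMatrix_nonneg' k M hM :=
    σ.map_cstarMatrix_nonneg' k _ (ρ.map_cstarMatrix_nonneg' k M hM)

@[simp] lemma compCP_apply {D D' D'' : Type*} [NonUnitalCStarAlgebra D] [PartialOrder D]
    [StarOrderedRing D] [NonUnitalCStarAlgebra D'] [PartialOrder D'] [StarOrderedRing D']
    [NonUnitalCStarAlgebra D''] [PartialOrder D''] [StarOrderedRing D'']
    (σ : D' →CP D'') (ρ : D →CP D') (d : D) : compCP σ ρ d = σ (ρ d) := rfl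

/-- The left action `π_ρ : A → End_B(A ⊗_ρ X)`, `π_ρ(a')(a ⊗ x) = a' a ⊗ x`, of the KSGNS
correspondence `A ⊗_ρ X`. -/
def ksgnsRep (ρ : A →CP Adj B X) : A →⋆ₙₐ[ℂ] Adj B (CPTensor A ρ) :=
  ((amp ρ : Adj A A →⋆ₐ[ℂ] _) : Adj A A →⋆ₙₐ[ℂ] Adj B (CPTensor A ρ)).comp (leftMul A)

lemma ksgnsRep_apply (ρ : A →CP Adj B X) (a : A) : ksgnsRep ρ a = amp ρ (leftMul A a) := rfl

lemma isStrict_leftMul : IsStrict (homCP (leftMul A)) := by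
  have hl := CStarAlgebra.increasingApproximateUnit A
  have := hl.neBot
  refine ⟨_, hl, fun x ↦ ⟨(hl.tendsto_mul_right x).cauchy_map, ?_⟩⟩
  refine ((hl.tendsto_mul_right x).congr' ?_).cauchy_map
  filter_upwards [hl.eventually_star_eq] with a ha
  rw [homCP_apply, ← map_star, ha, leftMul_apply]

section

variable {E : Type*} [NormedAddCommGroup E] [NormedSpace ℂ E] [SMul Aᵐᵒᵖ E] [CStarModule Aᵐᵒᵖ E]
  [CompleteSpace E]

lemma continuous_adj_apply (x : X) : Continuous fun T : Adj B X ↦ T x :=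
  (ContinuousLinearMap.apply ℂ X x).continuous.comp Adj.isometry_toCLM.continuous

lemma continuous_cp (ρ : A →CP Adj B X) : Continuous ρ := map_continuous ρ

lemma tendsto_ι_tmul (ρ : A →CP Adj B X) {α : Type*} {l : Filter α} {f : α → E} {e : E}
    (hf : Filter.Tendsto f l (nhds e)) (x : X) :
    Filter.Tendsto (fun a ↦ (cpForm E ρ).ι (f a ⊗ₜ[ℂ] x)) l (nhds ((cpForm E ρ).ι (e ⊗ₜ x))) := by
  rw [tendsto_iff_norm_sub_tendsto_zero]
  have h₁ : ∀ a, ‖(cpForm E ρ).ι (f a ⊗ₜ[ℂ] x) - (cpForm E ρ).ι (e ⊗ₜ x)‖ =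
      √‖rip B x (ρ (rip A (f a - e) (f a - e)) x)‖ := fun a ↦ by
    rw [← map_sub, ← TensorProduct.sub_tmul, ← Real.sqrt_sq (norm_nonneg _), SemiInner.norm_ι_sq]
    rfl
  simp only [h₁]
  have h₂ : Continuous fun y : E ↦ √‖rip B x (ρ (rip A (y - e) (y - e)) x)‖ := by
    refine (continuous_rip_comp continuous_const ?_).norm.sqrt
    refine (continuous_adj_apply x).comp ((continuous_cp ρ).comp ?_)
    exact continuous_rip_comp (by fun_prop) (by fun_prop)
  refine (h₂.tendsto' e 0 ?_).comp hf
  rw [sub_self, rip_zero_right, map_zero, Adj.zero_apply, rip_zero_right, norm_zero, Real.sqrt_zero]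

lemma cauchy_amp (ρ : A →CP Adj B X) {α : Type*} {l : Filter α} (F : α → Adj A E) {C : ℝ}
    (hC : ∀ᶠ a in l, ‖F a‖ ≤ C) (hF : ∀ e, Cauchy (l.map fun a ↦ F a e)) (z : CPTensor E ρ) :
    Cauchy (l.map fun a ↦ amp ρ (F a) z) := by
  have hl : l.NeBot := Filter.map_neBot_iff _ |>.1 (hF 0).1
  have h₁ : ∀ v, ∃ y, Filter.Tendsto (fun a ↦ amp ρ (F a) ((cpForm E ρ).ι v)) l (nhds y) := by
    intro v
    induction v with
    | zero => exact ⟨0, by simp only [map_zero]; exact tendsto_const_nhds⟩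
    | add v w hv hw =>
      obtain ⟨y, hy⟩ := hv
      obtain ⟨y', hy'⟩ := hw
      exact ⟨y + y', by simp only [map_add]; exact hy.add hy'⟩
    | tmul e x =>
      obtain ⟨e', he'⟩ := CompleteSpace.complete (hF e)
      exact ⟨_, by simp only [amp_ι, ampLin_tmul]; exact tendsto_ι_tmul ρ he' x⟩
  have hC0 : 0 ≤ C := by
    obtain ⟨a, ha⟩ := hC.exists
    exact (norm_nonneg _).trans ha
  rw [Metric.cauchy_iff]
  refine ⟨hl.map _, fun ε hε ↦ ?_⟩
  obtain ⟨v, hv⟩ := (cpForm E ρ).denseRange_ι.exists_dist_lt z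
    (show 0 < ε / (3 * (C + 1)) by positivity)
  obtain ⟨y, hy⟩ := h₁ v
  have hy' := (Metric.tendsto_nhds.1 hy (ε / 6) (by positivity))
  refine ⟨_, Filter.image_mem_map (hC.and hy'), ?_⟩
  have hb : ∀ a, ‖F a‖ ≤ C → dist (amp ρ (F a) z) (amp ρ (F a) ((cpForm E ρ).ι v)) ≤ ε / 3 := by
    intro a ha
    rw [dist_eq_norm, ← map_sub]
    refine (Adj.norm_apply_le _ _).trans ?_
    have h₂ : ‖amp ρ (F a)‖ ≤ C := (NonUnitalStarAlgHom.norm_apply_le (amp ρ) (F a)).trans ha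
    rw [dist_eq_norm] at hv
    calc _ ≤ C * (ε / (3 * (C + 1))) := by gcongr
      _ ≤ (C + 1) * (ε / (3 * (C + 1))) := by gcongr; linarith
      _ = ε / 3 := by field_simp
  rintro _ ⟨a, ⟨ha, ha'⟩, rfl⟩ _ ⟨b, ⟨hb', hb''⟩, rfl⟩
  have h₃ := hb a ha
  have h₄ := hb b hb'
  rw [dist_comm] at h₄
  rw [dist_comm] at hb''
  have h₅ := dist_triangle4 (amp ρ (F a) z) (amp ρ (F a) ((cpForm E ρ).ι v))
    (amp ρ (F b) ((cpForm E ρ).ι v)) (amp ρ (F b) z)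
  have h₆ := dist_triangle (amp ρ (F a) ((cpForm E ρ).ι v)) y (amp ρ (F b) ((cpForm E ρ).ι v))
  have h₇ : dist (amp ρ (F a) ((cpForm E ρ).ι v)) y < ε / 6 := ha'
  have h₈ : dist y (amp ρ (F b) ((cpForm E ρ).ι v)) < ε / 6 := hb''
  linarith

variable (E) in
/-- The map `T ↦ T ⊗ 1` on adjointable operators as a completely positive map. -/
def ampCP (σ : A →CP Adj B X) : Adj A E →CP Adj B (CPTensor E σ) :=
  homCP ((amp σ : Adj A E →⋆ₐ[ℂ] _) : Adj A E →⋆ₙₐ[ℂ] Adj B (CPTensor E σ))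

@[simp] lemma ampCP_apply (σ : A →CP Adj B X) (T : Adj A E) : ampCP E σ T = amp σ T := rfl

lemma isStrict_comp_ampCP {D : Type*} [NonUnitalCStarAlgebra D] [PartialOrder D]
    [StarOrderedRing D] (ρ : D →CP Adj A E) (σ : A →CP Adj B X) (hρ : IsStrict ρ) :
    IsStrict (compCP (ampCP E σ) ρ) := by
  obtain ⟨l, hl, h⟩ := hρ
  obtain ⟨C, hC⟩ := PositiveLinearMap.exists_norm_apply_le (.ofClass ρ)
  have hb : ∀ᶠ a in l, ‖ρ a‖ ≤ C := by
    filter_upwards [hl.eventually_norm] with a ha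
    calc _ ≤ C * ‖a‖ := hC a
      _ ≤ C * 1 := by gcongr
      _ = C := mul_one _
  refine ⟨l, hl, fun z ↦ ⟨cauchy_amp σ (fun a ↦ ρ a) hb (fun e ↦ (h e).1) z, ?_⟩⟩
  have h₁ := cauchy_amp σ (fun a ↦ star (ρ a))
    (by simpa only [norm_star] using hb) (fun e ↦ (h e).2) z
  simpa only [compCP_apply, ampCP_apply, map_star] using h₁

end

end Strict

section Morphisms

/-- A positive `A`–`B`-correspondence `(ρ, X)`: a right Hilbert `B`-module `X` with a completely
positive map `ρ : A → End_B(X)`. -/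
structure PosCorr (A B : Type u) [NonUnitalCStarAlgebra A] [PartialOrder A] [StarOrderedRing A]
    [NonUnitalCStarAlgebra B] [PartialOrder B] [StarOrderedRing B] where
  X : Type u
  [normedAddCommGroup : NormedAddCommGroup X]
  [normedSpace : NormedSpace ℂ X]
  [completeSpace : CompleteSpace X]
  [smul : SMul Bᵐᵒᵖ X]
  [cstarModule : CStarModule Bᵐᵒᵖ X]
  ρ : A →CP Adj B X

attribute [instance] PosCorr.normedAddCommGroup PosCorr.normedSpace PosCorr.completeSpace
  PosCorr.smul PosCorr.cstarModule

/-- A strict positive correspondence. -/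
structure StrictPosCorr (A B : Type u) [NonUnitalCStarAlgebra A] [PartialOrder A]
    [StarOrderedRing A] [NonUnitalCStarAlgebra B] [PartialOrder B] [StarOrderedRing B]
    extends PosCorr A B where
  strict : IsStrict ρ

/-- A `C*`-correspondence `(φ, X)`: a countably generated right Hilbert `B`-module `X` with a
`*`-homomorphism `φ : A → End_B(X)`. -/
structure Correspondence (A B : Type u) [NonUnitalCStarAlgebra A] [PartialOrder A]
    [StarOrderedRing A] [NonUnitalCStarAlgebra B] [PartialOrder B] [StarOrderedRing B] where
  X : Type u
  [normedAddCommGroup : NormedAddCommGroup X]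
  [normedSpace : NormedSpace ℂ X]
  [completeSpace : CompleteSpace X]
  [smul : SMul Bᵐᵒᵖ X]
  [cstarModule : CStarModule Bᵐᵒᵖ X]
  countably_generated : ∃ s : Set X, s.Countable ∧
    Dense (Submodule.span ℂ {z : X | ∃ x ∈ s, ∃ b : B, z = op b • x} : Set X)
  φ : A →⋆ₙₐ[ℂ] Adj B X

attribute [instance] Correspondence.normedAddCommGroup Correspondence.normedSpace
  Correspondence.completeSpace Correspondence.smul Correspondence.cstarModule

variable {A B C : Type u}
  [NonUnitalCStarAlgebra A] [PartialOrder A] [StarOrderedRing A]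
  [NonUnitalCStarAlgebra B] [PartialOrder B] [StarOrderedRing B]
  [NonUnitalCStarAlgebra C] [PartialOrder C] [StarOrderedRing C]

/-- Isomorphism of positive correspondences: an adjointable unitary `U : X → Y` such that
`U ρ(a) U* = σ(a)` for all `a`. -/
def PosCorr.Iso (P Q : PosCorr A B) : Prop :=
  ∃ U : AdjUnitary B P.X Q.X, ∀ (a : A) (y : Q.X), U.toCLM (P.ρ a (U.adj y)) = Q.ρ a y

lemma PosCorr.Iso.refl (P : PosCorr A B) : P.Iso P := ⟨.refl, fun _ _ ↦ rfl⟩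

lemma PosCorr.Iso.symm {P Q : PosCorr A B} (h : P.Iso Q) : Q.Iso P := by
  obtain ⟨U, hU⟩ := h
  refine ⟨U.symm, fun a y ↦ ?_⟩
  change U.adj (Q.ρ a (U.toCLM y)) = _
  rw [← hU, U.adj_toCLM, U.adj_toCLM]

lemma PosCorr.Iso.trans {P Q R : PosCorr A B} (h : P.Iso Q) (h' : Q.Iso R) : P.Iso R := by
  obtain ⟨U, hU⟩ := h
  obtain ⟨V, hV⟩ := h'
  refine ⟨U.trans V, fun a y ↦ ?_⟩
  change V.toCLM (U.toCLM (P.ρ a (U.adj (V.adj y)))) = _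
  rw [hU, hV]

lemma PosCorr.Iso.intertwines {P Q : PosCorr A B} {U : AdjUnitary B P.X Q.X}
    (hU : ∀ (a : A) (y : Q.X), U.toCLM (P.ρ a (U.adj y)) = Q.ρ a y) (a : A) (x : P.X) :
    U.toCLM (P.ρ a x) = Q.ρ a (U.toCLM x) := by
  rw [← hU, U.adj_toCLM]

/-- The composition of strict positive correspondences,
`(ρ, X) ⊗ (σ, Y) = (ρ ⊗ 1, X ⊗_B (B ⊗_σ Y))`: the internal tensor product of `X` with the KSGNS
correspondence `(π_σ, B ⊗_σ Y)` of `σ`. -/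
def StrictPosCorr.comp (P : StrictPosCorr A B) (Q : StrictPosCorr B C) : StrictPosCorr A C where
  X := CPTensor P.X (homCP (ksgnsRep Q.ρ))
  ρ := compCP (ampCP P.X (homCP (ksgnsRep Q.ρ))) P.ρ
  strict := isStrict_comp_ampCP P.ρ (homCP (ksgnsRep Q.ρ)) P.strict

lemma StrictPosCorr.comp_iso {P P' : StrictPosCorr A B} {Q Q' : StrictPosCorr B C}
    (hP : P.toPosCorr.Iso P'.toPosCorr) (hQ : Q.toPosCorr.Iso Q'.toPosCorr) :
    (P.comp Q).toPosCorr.Iso (P'.comp Q').toPosCorr := by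
  obtain ⟨U, hU⟩ := hP
  obtain ⟨W, hW⟩ := hQ
  let V := tensorUnitary (E := B) (E' := B) .refl W (PosCorr.Iso.intertwines hW)
  have hV : ∀ b z, V.toCLM (homCP (ksgnsRep Q.ρ) b z) = homCP (ksgnsRep Q'.ρ) b (V.toCLM z) :=
    fun b z ↦ tensorUnitary_amp .refl W (PosCorr.Iso.intertwines hW) _ _ (fun _ ↦ rfl) z
  refine ⟨tensorUnitary U V hV, fun a y ↦ ?_⟩
  refine (tensorUnitary_amp U V hV (P.ρ a) (P'.ρ a)
    (fun e ↦ PosCorr.Iso.intertwines hU a e) _).trans ?_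
  exact congrArg (amp (homCP (ksgnsRep Q'.ρ)) (P'.ρ a)) ((tensorUnitary U V hV).toCLM_adj y)

variable (A) in
/-- The strict positive correspondence `(Id, A)`. -/
def StrictPosCorr.id : StrictPosCorr A A where
  X := A
  ρ := homCP (leftMul A)
  strict := isStrict_leftMul

variable (A B) in
/-- Isomorphism as an equivalence relation on strict positive correspondences. -/
def strictSetoid : Setoid (StrictPosCorr A B) where
  r P Q := P.toPosCorr.Iso Q.toPosCorr
  iseqv := ⟨fun _ ↦ .refl _, fun h ↦ h.symm, fun h h' ↦ h.trans h'⟩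

variable (A B) in
/-- The morphisms from `A` to `B` in the positive correspondence semi-category: isomorphism classes
of strict positive `A`–`B`-correspondences. -/
def Hom : Type (u + 1) := Quotient (strictSetoid A B)

/-- The class of a strict positive correspondence. -/
def Hom.mk (P : StrictPosCorr A B) : Hom A B := Quotient.mk (strictSetoid A B) P

/-- Composition of morphisms: `[P] ⊗ [Q] = [P ⊗ Q]`. -/
def Hom.comp (m : Hom A B) (n : Hom B C) : Hom A C :=
  Quotient.map₂ (sa := strictSetoid A B) (sb := strictSetoid B C) (sc := strictSetoid A C)
    StrictPosCorr.comp (fun _ _ h _ _ h' ↦ StrictPosCorr.comp_iso h h') m n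

variable (A) in
/-- The right identity morphism `[(Id, A)]` of `A`. -/
def Hom.id : Hom A A := Hom.mk (StrictPosCorr.id A)

/-- A morphism is invertible if it has a two-sided inverse relative to the right identities. -/
def Hom.IsInvertible (m : Hom A B) : Prop :=
  ∃ n : Hom B A, m.comp n = Hom.id A ∧ n.comp m = Hom.id B

/-- A `C*`-correspondence as a positive correspondence. -/
def Correspondence.toPosCorr (M : Correspondence A B) : PosCorr A B where
  X := M.X
  ρ := homCP M.φ

/-- A Morita equivalence bimodule: a regular correspondence (`φ` is injective with values in the
compact operators) such that `X` is full and `φ(A) = End⁰_B(X)`. -/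
structure Correspondence.IsMorita (M : Correspondence A B) : Prop where
  injective : Function.Injective M.φ
  compact : ∀ a, M.φ a ∈ Adj.compacts B M.X
  full : Dense (Submodule.span ℂ {b : B | ∃ x y : M.X, b = rip B x y} : Set B)
  range_eq : Set.range M.φ = (Adj.compacts B M.X : Set (Adj B M.X))

/-- The morphism `m` is the class of the `C*`-correspondence `M` (in particular, `M` is strict). -/
def Hom.IsClassOf (m : Hom A B) (M : Correspondence A B) : Prop :=
  ∃ h : IsStrict M.toPosCorr.ρ, m = Hom.mk ⟨M.toPosCorr, h⟩

end Morphisms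

end

end Quesadilla

/-! Suppose first that $(\rho,X)$ and $(\sigma,Y)$ are mutually inverse. A unitary from the
composite to $A_A$ carries $\rho(a)\otimes 1$ to left multiplication by $a$, so $\rho$ has trivial
kernel (`eq_zero_of_comp_iso_id`), and by symmetry so does $\sigma$. Trivial kernel of $\sigma$
makes $T\mapsto T\otimes 1$ injective on $\mathrm{End}_B(X)$ (`amp_ksgnsRep_injective`). Since
$\rho(ab)\otimes 1$ and $\rho(a)\rho(b)\otimes 1$ both correspond to multiplication by $ab$, the map
$\rho$ is multiplicative. Strictness gives a limit of $\rho(a_i)x$, and after tensoring this limit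
must be $x$, so $\rho$ is nondegenerate. The same holds for $\sigma$. For nondegenerate
$*$-homomorphisms the KSGNS modules collapse (`ksgnsUnitary`), leaving unitaries $X\otimes_\sigma
Y\cong A$ and $V\colon Y\otimes_\rho X\cong B$.

These unitaries exhibit $Y$ as a dual of $X$: each $y\in Y$ has a vector $w\in X$ with $\langle w,
x\rangle = V(y\otimes x)$ for all $x$ (`exists_rip_eq_of_unitary`). If $w,w'$ represent $y,y'$, then
$\rho(\langle y,y'\rangle)$ is the rank-one operator $\Theta_{w,w'}$ (`apply_rip_eq_rankOne`). As
$Y$ is full, $\rho(A)$ consists of compact operators. As the representing vectors are dense and the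
range of an injective $*$-homomorphism is closed, $\rho(A)$ contains all of them. Separability of
$A$ gives countable generation.

Conversely, for a Morita bimodule $(\phi,X)$ set $\langle x,y\rangle_A=\phi^{-1}(\Theta_{x,y})$.
This makes the conjugate space $\tilde X$ a Hilbert $A$-module on which $B$ acts from the left, and
$x\otimes\tilde y\mapsto\langle x,y\rangle_A$ and $\tilde x\otimes y\mapsto\langle x,y\rangle_B$ are
unitaries onto $A$ and $B$ intertwining the left actions. -/

namespace Quesadilla

noncomputable section

set_option linter.unusedSectionVars false

/-! ### Unitaries out of completions and tensor products -/

section Unitaries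

variable {A B E X Y : Type*}
  [NonUnitalCStarAlgebra A] [PartialOrder A] [StarOrderedRing A]
  [NonUnitalCStarAlgebra B] [PartialOrder B] [StarOrderedRing B]
  [NormedAddCommGroup E] [NormedSpace ℂ E] [SMul Aᵐᵒᵖ E] [CStarModule Aᵐᵒᵖ E]
  [NormedAddCommGroup X] [NormedSpace ℂ X] [SMul Bᵐᵒᵖ X] [CStarModule Bᵐᵒᵖ X] [CompleteSpace X]
  [NormedAddCommGroup Y] [NormedSpace ℂ Y] [SMul Bᵐᵒᵖ Y] [CStarModule Bᵐᵒᵖ Y] [CompleteSpace Y]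

lemma norm_eq_of_rip_self_eq {x : X} {y : Y} (h : rip B x x = rip B y y) : ‖x‖ = ‖y‖ := by
  rw [← sq_eq_sq₀ (norm_nonneg _) (norm_nonneg _), norm_sq_eq_rip (B := B), h,
    ← norm_sq_eq_rip (B := B)]

/-- A surjective bounded operator preserving the inner products is an adjointable unitary. -/
def AdjUnitary.ofSurjective (F : X →L[ℂ] Y) (h : ∀ x y, rip B (F x) (F y) = rip B x y)
    (hF : Function.Surjective F) : AdjUnitary B X Y :=
  let G : X →ₗᵢ[ℂ] Y := ⟨F.toLinearMap, fun x ↦ norm_eq_of_rip_self_eq (h x x)⟩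
  let e := LinearIsometryEquiv.ofSurjective G hF
  have he : ∀ x, e x = F x := fun _ ↦ rfl
  { toCLM := F
    adj := e.symm.toContinuousLinearEquiv.toContinuousLinearMap
    rip_adj := fun x y ↦ by
      obtain ⟨z, rfl⟩ := e.surjective y
      change rip B (F x) (F z) = rip B x (e.symm (e z))
      rw [e.symm_apply_apply, h]
    adj_toCLM := fun x ↦ e.symm_apply_apply x
    toCLM_adj := fun y ↦ e.apply_symm_apply y }

lemma SemiInner.norm_apply_le_of_form {V : Type*} [AddCommGroup V] [Module ℂ V] (S : SemiInner B V)
    (f : V →ₗ[ℂ] Y) (h : ∀ v w, rip B (f v) (f w) = S.form v w) (v : V) :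
    ‖f v‖ ≤ 1 * ‖S.ι v‖ := by
  rw [one_mul, norm_eq_of_rip_self_eq (B := B) (x := f v) (y := S.ι v) (by rw [h, S.rip_ι])]

/-- A form-preserving linear map with dense range from a semi-inner product module to a Hilbert
module induces a unitary on the completion. -/
def SemiInner.unitaryOfDense {V : Type*} [AddCommGroup V] [Module ℂ V] (S : SemiInner B V)
    (f : V →ₗ[ℂ] Y) (h : ∀ v w, rip B (f v) (f w) = S.form v w) (hd : DenseRange f) :
    AdjUnitary B S.Space Y :=
  have hb := S.norm_apply_le_of_form f h
  have hr : ∀ x y, rip B (S.lift f 1 hb x) (S.lift f 1 hb y) = rip B x y :=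
    S.ind₂ (isClosed_eq
      (continuous_rip_comp ((S.lift f 1 hb).continuous.comp continuous_fst)
        ((S.lift f 1 hb).continuous.comp continuous_snd))
      (continuous_rip_comp continuous_fst continuous_snd)) fun v w ↦ by
        rw [S.lift_ι, S.lift_ι, h, S.rip_ι]
  .ofSurjective (S.lift f 1 hb) hr <| by
    have hi : Isometry (S.lift f 1 hb) := AddMonoidHomClass.isometry_of_norm _ fun x ↦
      norm_eq_of_rip_self_eq (B := B) (hr x x)
    have hd' : DenseRange (S.lift f 1 hb) := by
      refine Dense.mono ?_ hd
      rintro _ ⟨v, rfl⟩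
      exact ⟨S.ι v, S.lift_ι f 1 hb v⟩
    -- An isometry from a complete space has closed range, so dense range already gives
    -- surjectivity.
    rw [← Set.range_eq_univ, ← hd'.closure_range]
    exact hi.isClosedEmbedding.isClosed_range.closure_eq.symm

lemma SemiInner.unitaryOfDense_ι {V : Type*} [AddCommGroup V] [Module ℂ V] (S : SemiInner B V)
    (f : V →ₗ[ℂ] Y) (h : ∀ v w, rip B (f v) (f w) = S.form v w) (hd : DenseRange f) (v : V) :
    (S.unitaryOfDense f h hd).toCLM (S.ι v) = f v :=
  S.lift_ι f 1 (S.norm_apply_le_of_form f h) v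

/-- A bilinear map which is compatible with the inner products and whose values span a dense
subspace induces a unitary on the tensor product. -/
def CPTensor.unitary {ρ : A →CP Adj B X} (f : E →ₗ[ℂ] X →ₗ[ℂ] Y)
    (h : ∀ e x e' x', rip B (f e x) (f e' x') = rip B x (ρ (rip A e e') x'))
    (hd : Dense (Submodule.span ℂ {y : Y | ∃ e x, y = f e x} : Set Y)) :
    AdjUnitary B (CPTensor E ρ) Y :=
  (cpForm E ρ).unitaryOfDense (TensorProduct.lift f)
    (fun v w ↦ by
      change _ = cpSesq E ρ v w
      induction w with
      | zero => simp [rip_zero_right]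
      | add w₁ w₂ h₁ h₂ => simp only [map_add, rip_add_right, h₁, h₂]
      | tmul e' x' =>
        induction v with
        | zero => simp [rip]
        | add v₁ v₂ h₁ h₂ => simp only [map_add, LinearMap.add_apply, rip_add_left, h₁, h₂]
        | tmul e x => simp only [TensorProduct.lift.tmul, h, cpSesq_tmul])
    (by
      refine hd.mono (SetLike.coe_subset_coe.2 (?_ : _ ≤ LinearMap.range (TensorProduct.lift f)))
      rw [Submodule.span_le]
      rintro _ ⟨e, x, rfl⟩
      exact ⟨e ⊗ₜ x, TensorProduct.lift.tmul e x⟩)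

lemma CPTensor.unitary_ι_tmul {ρ : A →CP Adj B X} (f : E →ₗ[ℂ] X →ₗ[ℂ] Y)
    (h : ∀ e x e' x', rip B (f e x) (f e' x') = rip B x (ρ (rip A e e') x'))
    (hd : Dense (Submodule.span ℂ {y : Y | ∃ e x, y = f e x} : Set Y)) (e : E) (x : X) :
    (CPTensor.unitary f h hd).toCLM ((cpForm E ρ).ι (e ⊗ₜ x)) = f e x :=
  (SemiInner.unitaryOfDense_ι ..).trans (TensorProduct.lift.tmul e x)

lemma CPTensor.ext_ι_tmul {ρ : A →CP Adj B X} {Z : Type*} [NormedAddCommGroup Z] [NormedSpace ℂ Z]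
    {f g : CPTensor E ρ →L[ℂ] Z}
    (h : ∀ e x, f ((cpForm E ρ).ι (e ⊗ₜ x)) = g ((cpForm E ρ).ι (e ⊗ₜ x))) (z : CPTensor E ρ) :
    f z = g z := by
  refine (cpForm E ρ).ind₁ (p := fun z ↦ f z = g z) (isClosed_eq f.continuous g.continuous)
    (fun v ↦ ?_) z
  induction v with
  | zero => simp
  | add v w hv hw => simp only [map_add, hv, hw]
  | tmul e x => exact h e x

lemma CPTensor.rip_ι_tmul (ρ : A →CP Adj B X) (e e' : E) (x x' : X) :
    rip B ((cpForm E ρ).ι (e ⊗ₜ x)) ((cpForm E ρ).ι (e' ⊗ₜ x')) = rip B x (ρ (rip A e e') x') :=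
  SemiInner.rip_ι ..

lemma amp_ι_tmul [CompleteSpace E] (ρ : A →CP Adj B X) (T : Adj A E) (e : E) (x : X) :
    amp ρ T ((cpForm E ρ).ι (e ⊗ₜ x)) = (cpForm E ρ).ι (T e ⊗ₜ x) :=
  amp_ι ρ T _

end Unitaries

/-! ### Nondegenerate `*`-homomorphisms and their KSGNS modules -/

section Nondegenerate

variable {A B X : Type*}
  [NonUnitalCStarAlgebra A] [PartialOrder A] [StarOrderedRing A]
  [NonUnitalCStarAlgebra B] [PartialOrder B] [StarOrderedRing B]
  [NormedAddCommGroup X] [NormedSpace ℂ X] [SMul Bᵐᵒᵖ X] [CStarModule Bᵐᵒᵖ X] [CompleteSpace X]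

/-- Every vector is in the closed linear span of `ρ(A) X`. -/
def IsNondegenerate (ρ : A →CP Adj B X) : Prop :=
  Dense (Submodule.span ℂ {z : X | ∃ a x, z = ρ a x} : Set X)

/-- The uniform bound makes the operators equicontinuous, so pointwise convergence passes from a
total set to all of `X`. -/
lemma tendsto_apply_of_dense {α : Type*} {l : Filter α} {F : α → Adj B X}
    (hF : ∀ᶠ a in l, ‖F a‖ ≤ 1) {s : Set X} (hs : Dense (Submodule.span ℂ s : Set X))
    (h : ∀ x ∈ s, Filter.Tendsto (fun a ↦ F a x) l (nhds x)) (x : X) :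
    Filter.Tendsto (fun a ↦ F a x) l (nhds x) := by
  have hspan : ∀ v ∈ Submodule.span ℂ s, Filter.Tendsto (fun a ↦ F a v) l (nhds v) := by
    intro v hv
    induction hv using Submodule.span_induction with
    | mem v hv => exact h v hv
    | zero => simpa only [map_zero] using tendsto_const_nhds
    | add v w _ _ hv hw => simpa only [map_add] using hv.add hw
    | smul c v _ hv => simpa only [map_smul] using hv.const_smul c
  rw [Metric.tendsto_nhds]
  intro ε hε
  obtain ⟨v, hv, hxv⟩ := hs.exists_dist_lt x (show 0 < ε / 3 by positivity)
  filter_upwards [hF, Metric.tendsto_nhds.1 (hspan v hv) (ε / 3) (by positivity)] with a ha hav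
  have h₁ : dist (F a x) (F a v) ≤ dist x v := by
    rw [dist_eq_norm, dist_eq_norm, ← map_sub]
    refine (Adj.norm_apply_le _ _).trans ?_
    exact mul_le_of_le_one_left (norm_nonneg _) ha
  have h₂ := dist_triangle4 (F a x) (F a v) v x
  rw [dist_comm v x] at h₂
  linarith

variable {ρ : A →CP Adj B X}

/-- A multiplicative completely positive map as a `*`-homomorphism. -/
def homOfMul (ρ : A →CP Adj B X) (hmul : ∀ a b, ρ (a * b) = ρ a * ρ b) :
    A →⋆ₙₐ[ℂ] Adj B X where
  toFun := ρ
  map_smul' c a := map_smul ρ c a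
  map_zero' := map_zero ρ
  map_add' := map_add ρ
  map_mul' := hmul
  map_star' := map_star_of_cp ρ

/-- On a vector `ρ b x` the net is `ρ (a * b) x`, which converges because `ρ` is norm continuous.
Contractivity of `*`-homomorphisms extends this to the closed span. -/
lemma IsNondegenerate.tendsto (h : IsNondegenerate ρ) (hmul : ∀ a b, ρ (a * b) = ρ a * ρ b)
    {l : Filter A} (hl : l.IsIncreasingApproximateUnit) (x : X) :
    Filter.Tendsto (fun a ↦ ρ a x) l (nhds x) := by
  refine tendsto_apply_of_dense ?_ h ?_ x
  · filter_upwards [hl.eventually_norm] with a ha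
    exact (NonUnitalStarAlgHom.norm_apply_le (homOfMul ρ hmul) a).trans ha
  · rintro _ ⟨a, x, rfl⟩
    have := ((continuous_adj_apply x).comp (continuous_cp ρ)).tendsto a |>.comp
      (hl.tendsto_mul_right a)
    refine this.congr fun b ↦ ?_
    simp only [Function.comp_apply, hmul, Adj.mul_apply]

lemma IsNondegenerate.isStrict (h : IsNondegenerate ρ) (hmul : ∀ a b, ρ (a * b) = ρ a * ρ b) :
    IsStrict ρ := by
  have hl := CStarAlgebra.increasingApproximateUnit A
  have := hl.neBot
  refine ⟨_, hl, fun x ↦ ⟨(h.tendsto hmul hl x).cauchy_map, ?_⟩⟩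
  -- The approximate unit is eventually self-adjoint, so the net of adjoints is the same net.
  refine ((h.tendsto hmul hl x).congr' ?_).cauchy_map
  filter_upwards [hl.eventually_star_eq] with a ha
  rw [← map_star_of_cp, ha]

/-- For a nondegenerate `*`-homomorphism `ρ`, the KSGNS module is `A ⊗_ρ X ≅ X`. -/
def ksgnsUnitary (h : IsNondegenerate ρ) (hmul : ∀ a b, ρ (a * b) = ρ a * ρ b) :
    AdjUnitary B (CPTensor A ρ) X :=
  CPTensor.unitary (LinearMap.mk₂ ℂ (fun a x ↦ ρ a x)
      (fun a b x ↦ by rw [map_add, Adj.add_apply])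
      (fun c a x ↦ by rw [map_smul, Adj.smul_apply])
      (fun a x y ↦ map_add _ _ _)
      (fun c a x ↦ map_smul _ _ _))
    (fun a x a' x' ↦ by
      change rip B (ρ a x) (ρ a' x') = rip B x (ρ (star a * a') x')
      rw [hmul, map_star_of_cp, Adj.mul_apply, Adj.rip_star_right])
    -- The required density of the vectors `ρ a x` is nondegeneracy itself.
    h

lemma ksgnsUnitary_ι_tmul (h : IsNondegenerate ρ) (hmul : ∀ a b, ρ (a * b) = ρ a * ρ b) (a : A)
    (x : X) : (ksgnsUnitary h hmul).toCLM ((cpForm A ρ).ι (a ⊗ₜ x)) = ρ a x :=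
  CPTensor.unitary_ι_tmul ..

lemma ksgnsUnitary_ksgnsRep (h : IsNondegenerate ρ) (hmul : ∀ a b, ρ (a * b) = ρ a * ρ b) (a : A)
    (z : CPTensor A ρ) :
    (ksgnsUnitary h hmul).toCLM (homCP (ksgnsRep ρ) a z) =
      ρ a ((ksgnsUnitary h hmul).toCLM z) := by
  refine CPTensor.ext_ι_tmul
    (f := (ksgnsUnitary h hmul).toCLM ∘L (homCP (ksgnsRep ρ) a).toCLM)
    (g := (ρ a).toCLM ∘L (ksgnsUnitary h hmul).toCLM) (fun b x ↦ ?_) z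
  change (ksgnsUnitary h hmul).toCLM (amp ρ (leftMul A a) _) =
    ρ a ((ksgnsUnitary h hmul).toCLM _)
  rw [amp_ι_tmul, ksgnsUnitary_ι_tmul, ksgnsUnitary_ι_tmul, leftMul_apply, hmul, Adj.mul_apply]

/-- With $g=\langle x,x\rangle$ one has $\|xb-x\|^2=\|b^*(gb-g)-(gb-g)\|$, and $gb\to g$ in norm
while $b$ stays in the unit ball. -/
lemma tendsto_act {l : Filter B} (hl : l.IsIncreasingApproximateUnit) (x : X) :
    Filter.Tendsto (fun b ↦ op b • x) l (nhds x) := by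
  rw [tendsto_iff_norm_sub_tendsto_zero]
  have h₁ : ∀ b, ‖op b • x - x‖ = √‖star b * (rip B x x * b - rip B x x) -
      (rip B x x * b - rip B x x)‖ := fun b ↦ by
    rw [← Real.sqrt_sq (norm_nonneg (op b • x - x)), norm_sq_eq_rip (B := B)]
    simp only [rip_sub_left, rip_sub_right, rip_act_left, rip_act_right, mul_sub]
    congr 2
    noncomm_ring
  simp only [h₁]
  have h₂ : Filter.Tendsto (fun b ↦ rip B x x * b - rip B x x) l (nhds 0) := by
    simpa using (hl.tendsto_mul_left (rip B x x)).sub_const (rip B x x)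
  have h₃ : Filter.Tendsto (fun b ↦ star b * (rip B x x * b - rip B x x)) l (nhds 0) := by
    refine squeeze_zero_norm' ?_ (tendsto_zero_iff_norm_tendsto_zero.1 h₂)
    filter_upwards [hl.eventually_norm] with b hb
    refine (norm_mul_le _ _).trans ?_
    rw [norm_star]
    exact mul_le_of_le_one_left (norm_nonneg _) hb
  simpa using (h₃.sub h₂).norm.sqrt

end Nondegenerate

/-! ### Faithfulness of tensoring with a KSGNS module -/

section Faithful

variable {A B X Y : Type*}
  [NonUnitalCStarAlgebra A] [PartialOrder A] [StarOrderedRing A]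
  [NonUnitalCStarAlgebra B] [PartialOrder B] [StarOrderedRing B]
  [NormedAddCommGroup X] [NormedSpace ℂ X] [SMul Aᵐᵒᵖ X] [CStarModule Aᵐᵒᵖ X] [CompleteSpace X]
  [NormedAddCommGroup Y] [NormedSpace ℂ Y] [SMul Bᵐᵒᵖ Y] [CStarModule Bᵐᵒᵖ Y] [CompleteSpace Y]

lemma eq_zero_of_forall_mul_right_eq_zero {a : A} (h : ∀ b, a * b = 0) : a = 0 :=
  CStarRing.mul_star_self_eq_zero_iff a |>.1 (h (star a))

/-- Pairing $x\otimes(b\otimes y)$ with $x\otimes(b'\otimes y')$ gives $\langle y,\sigma(b^*\langle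
x,x\rangle b')y'\rangle=0$. Trivial kernel of `σ` alone then yields $b^*\langle x,x\rangle b'=0$; no
multiplicativity is needed, because the KSGNS module has moved all products inside `σ`. -/
lemma eq_zero_of_forall_ι_tmul_eq_zero {σ : A →CP Adj B Y} (hσ : ∀ a, σ a = 0 → a = 0) {x : X}
    (h : ∀ z : CPTensor A σ, (cpForm X (homCP (ksgnsRep σ))).ι (x ⊗ₜ z) = 0) : x = 0 := by
  rw [← rip_self_eq_zero (B := A)]
  have h₁ : ∀ b b', star b * (rip A x x * b') = 0 := fun b b' ↦ by
    refine hσ _ (Adj.ext fun y' ↦ rip_ext_right (B := B) fun y ↦ ?_)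
    have h₂ := CPTensor.rip_ι_tmul (homCP (ksgnsRep σ)) x x ((cpForm A σ).ι (b ⊗ₜ y))
      ((cpForm A σ).ι (b' ⊗ₜ y'))
    rw [h ((cpForm A σ).ι (b' ⊗ₜ y')), rip_zero_right, homCP_apply,
      ksgnsRep_apply, amp_ι_tmul, CPTensor.rip_ι_tmul, leftMul_apply] at h₂
    rw [Adj.zero_apply, rip_zero_right]
    exact h₂.symm
  refine eq_zero_of_forall_mul_right_eq_zero fun b' ↦ ?_
  -- Take $b=\langle x,x\rangle b'$.
  exact (CStarRing.star_mul_self_eq_zero_iff _).1 (h₁ _ b')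

/-- If $T\otimes 1=0$ then $Tx\otimes z=0$ for all $z$, hence $Tx=0$. This allows operator
identities on the composite to be pulled back to the first factor. -/
lemma amp_ksgnsRep_injective {σ : A →CP Adj B Y} (hσ : ∀ a, σ a = 0 → a = 0) :
    Function.Injective (amp (E := X) (homCP (ksgnsRep σ))) := by
  rw [injective_iff_map_eq_zero]
  refine fun T hT ↦ Adj.ext fun x ↦ eq_zero_of_forall_ι_tmul_eq_zero hσ fun z ↦ ?_
  rw [← amp_ι_tmul, hT, Adj.zero_apply]

end Faithful

/-! ### Consequences of a composite being the identity -/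

section CompEqId

variable {A B : Type u}
  [NonUnitalCStarAlgebra A] [PartialOrder A] [StarOrderedRing A]
  [NonUnitalCStarAlgebra B] [PartialOrder B] [StarOrderedRing B]
  {P : StrictPosCorr A B} {Q : StrictPosCorr B A}

lemma exists_unitary_of_comp_iso_id (h : (P.comp Q).toPosCorr.Iso (StrictPosCorr.id A).toPosCorr) :
    ∃ U : AdjUnitary A (CPTensor P.X (homCP (ksgnsRep Q.ρ))) A,
      ∀ a z, U.toCLM (amp (homCP (ksgnsRep Q.ρ)) (P.ρ a) z) = a * U.toCLM z := by
  obtain ⟨U, hU⟩ := h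
  exact ⟨U, PosCorr.Iso.intertwines hU⟩

/-- The unitary turns $\rho(a)\otimes 1$ into left multiplication by $a$, so $\rho(a)=0$ forces
$aA=0$. -/
lemma eq_zero_of_comp_iso_id (h : (P.comp Q).toPosCorr.Iso (StrictPosCorr.id A).toPosCorr) (a : A)
    (ha : P.ρ a = 0) : a = 0 := by
  obtain ⟨U, hU⟩ := exists_unitary_of_comp_iso_id h
  refine eq_zero_of_forall_mul_right_eq_zero fun b ↦ ?_
  rw [← U.toCLM_adj b, ← hU, ha, map_zero, Adj.zero_apply, map_zero]

/-- Both $\rho(ab)\otimes 1$ and $\rho(a)\rho(b)\otimes 1$ become left multiplication by $ab$, and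
faithfulness of the second factor separates operators on the first. -/
lemma map_mul_of_comp_iso_id (h : (P.comp Q).toPosCorr.Iso (StrictPosCorr.id A).toPosCorr)
    (hQ : ∀ b, Q.ρ b = 0 → b = 0) (a b : A) : P.ρ (a * b) = P.ρ a * P.ρ b := by
  obtain ⟨U, hU⟩ := exists_unitary_of_comp_iso_id h
  refine amp_ksgnsRep_injective hQ (Adj.ext fun z ↦ ?_)
  have h₁ : amp (homCP (ksgnsRep Q.ρ)) (P.ρ a * P.ρ b) z =
      amp (homCP (ksgnsRep Q.ρ)) (P.ρ a) (amp (homCP (ksgnsRep Q.ρ)) (P.ρ b) z) :=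
    congrArg (fun T : Adj A _ ↦ T z) (map_mul (amp (homCP (ksgnsRep Q.ρ))) (P.ρ a) (P.ρ b))
  refine (U.adj_toCLM _).symm.trans (Eq.trans (congrArg U.adj ?_) (U.adj_toCLM _))
  rw [h₁, hU, hU, hU, mul_assoc]

/-- Strictness provides a limit $y$ of $\rho(a_i)x$. In the tensor product $\rho(a_i)x\otimes z$
tends both to $y\otimes z$ and, since $a_i$ acts there as an approximate unit on $A$, to $x\otimes
z$. Faithfulness gives $y=x$. -/
lemma isNondegenerate_of_comp_iso_id
    (h : (P.comp Q).toPosCorr.Iso (StrictPosCorr.id A).toPosCorr)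
    (hQ : ∀ b, Q.ρ b = 0 → b = 0) : IsNondegenerate P.ρ := by
  obtain ⟨U, hU⟩ := exists_unitary_of_comp_iso_id h
  obtain ⟨l, hl, hP⟩ := P.strict
  have := hl.neBot
  intro x
  obtain ⟨y, hy⟩ := CompleteSpace.complete (hP x).1
  have hy : Filter.Tendsto (fun a ↦ P.ρ a x) l (nhds y) := hy
  have hxy : y - x = 0 := by
    refine eq_zero_of_forall_ι_tmul_eq_zero hQ fun z ↦ ?_
    set S := cpForm P.X (homCP (ksgnsRep Q.ρ))
    have h₁ := tendsto_ι_tmul (homCP (ksgnsRep Q.ρ)) hy z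
    have h₂ : Filter.Tendsto (fun a ↦ S.ι (P.ρ a x ⊗ₜ z)) l (nhds (S.ι (x ⊗ₜ z))) := by
      have h₃ := (U.adj.continuous.tendsto _).comp
        (hl.tendsto_mul_right (U.toCLM (S.ι (x ⊗ₜ z))))
      rw [U.adj_toCLM] at h₃
      refine h₃.congr fun a ↦ ?_
      rw [Function.comp_apply, ← hU, U.adj_toCLM, amp_ι_tmul]
    rw [TensorProduct.sub_tmul, map_sub, tendsto_nhds_unique h₁ h₂, sub_self]
  rw [sub_eq_zero] at hxy
  rw [hxy] at hy
  exact mem_closure_of_tendsto hy <| .of_forall fun a ↦ Submodule.subset_span ⟨a, x, rfl⟩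

/-- When the second factor is a nondegenerate `*`-homomorphism, the KSGNS module can be omitted from
the composition. -/
lemma comp_iso_id_iff (hmul : ∀ b b', Q.ρ (b * b') = Q.ρ b * Q.ρ b') (hnd : IsNondegenerate Q.ρ) :
    (P.comp Q).toPosCorr.Iso (StrictPosCorr.id A).toPosCorr ↔
      ∃ U : AdjUnitary A (CPTensor P.X Q.ρ) A,
        ∀ a z, U.toCLM (amp Q.ρ (P.ρ a) z) = a * U.toCLM z := by
  -- `W` is the identity on `P.X` tensored with the collapse of the KSGNS module, so it commutes
  -- with operators acting on the first factor only.
  let W : AdjUnitary A (CPTensor P.X (homCP (ksgnsRep Q.ρ))) (CPTensor P.X Q.ρ) :=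
    tensorUnitary .refl (ksgnsUnitary hnd hmul) (ksgnsUnitary_ksgnsRep hnd hmul)
  have hW : ∀ a z, W.toCLM (amp (homCP (ksgnsRep Q.ρ)) (P.ρ a) z) = amp Q.ρ (P.ρ a) (W.toCLM z) :=
    fun a z ↦ tensorUnitary_amp .refl (ksgnsUnitary hnd hmul) (ksgnsUnitary_ksgnsRep hnd hmul)
      (P.ρ a) (P.ρ a) (fun _ ↦ rfl) z
  constructor
  · intro h
    obtain ⟨U, hU⟩ := exists_unitary_of_comp_iso_id h
    refine ⟨W.symm.trans U, fun a z ↦ ?_⟩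
    change U.toCLM (W.adj _) = a * U.toCLM (W.adj z)
    rw [← hU, ← W.adj_toCLM (amp _ (P.ρ a) (W.adj z)), hW, W.toCLM_adj]
  · rintro ⟨U, hU⟩
    refine ⟨W.trans U, fun a (y : A) ↦ ?_⟩
    change U.toCLM (W.toCLM (amp (homCP (ksgnsRep Q.ρ)) (P.ρ a) (W.adj (U.adj y)))) = a * y
    rw [hW, hU, W.toCLM_adj, U.toCLM_adj]

end CompEqId

/-! ### Vectors of `Y` as functionals on `X` -/

section DualVectors

variable {A B X Y : Type*}
  [NonUnitalCStarAlgebra A] [PartialOrder A] [StarOrderedRing A]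
  [NonUnitalCStarAlgebra B] [PartialOrder B] [StarOrderedRing B]
  [NormedAddCommGroup X] [NormedSpace ℂ X] [SMul Bᵐᵒᵖ X] [CStarModule Bᵐᵒᵖ X] [CompleteSpace X]
  [NormedAddCommGroup Y] [NormedSpace ℂ Y] [SMul Aᵐᵒᵖ Y] [CStarModule Aᵐᵒᵖ Y] [CompleteSpace Y]

variable (B) in
/-- The functional `x ↦ ⟨w, x⟩`. -/
def ripCLM (w : X) : X →L[ℂ] B :=
  LinearMap.mkContinuous
    { toFun := rip B w
      map_add' := rip_add_right w
      map_smul' := fun c x ↦ rip_smul_right c w x } ‖w‖ (norm_rip_le w)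

@[simp] lemma ripCLM_apply (w x : X) : ripCLM B w x = rip B w x := rfl

/-- Cauchy–Schwarz bounds the norm above and evaluation at the vector itself bounds it below. With
completeness of `X` this makes the representable functionals a closed subspace, so representability
can be checked on a total set. -/
lemma isometry_ripCLM : Isometry (ripCLM B : X → X →L[ℂ] B) := by
  refine Isometry.of_dist_eq fun w w' ↦ ?_
  have h : ripCLM B w - ripCLM B w' = ripCLM B (w - w') :=
    ContinuousLinearMap.ext fun x ↦ (rip_sub_left w w' x).symm
  rw [dist_eq_norm, dist_eq_norm, h]
  refine le_antisymm (LinearMap.mkContinuous_norm_le _ (norm_nonneg _) _) ?_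
  have h₁ := (ripCLM B (w - w')).le_opNorm (w - w')
  rw [ripCLM_apply, ← norm_sq_eq_rip (B := B), sq] at h₁
  rcases (norm_nonneg (w - w')).eq_or_lt with h₀ | h₀
  · rw [← h₀]
    exact norm_nonneg _
  · exact le_of_mul_le_mul_right h₁ h₀

variable (B X) in
/-- The space of the functionals `x ↦ ⟨w, x⟩`. -/
def ripFunctionals : Submodule ℂ (X →L[ℂ] B) where
  carrier := Set.range (ripCLM B)
  zero_mem' := ⟨0, ContinuousLinearMap.ext fun x ↦ by simp [rip]⟩
  add_mem' := by
    rintro _ _ ⟨w, rfl⟩ ⟨w', rfl⟩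
    exact ⟨w + w', ContinuousLinearMap.ext fun x ↦ rip_add_left w w' x⟩
  smul_mem' := by
    rintro c _ ⟨w, rfl⟩
    exact ⟨star c • w, ContinuousLinearMap.ext fun x ↦ by simp [rip_smul_left]⟩

lemma isClosed_ripFunctionals : IsClosed (ripFunctionals B X : Set (X →L[ℂ] B)) :=
  isometry_ripCLM.isClosedEmbedding.isClosed_range

/-- The constant is $1$ because a `*`-homomorphism is contractive. -/
lemma norm_ι_tmul_le {ρ : A →CP Adj B X} (hmul : ∀ a b, ρ (a * b) = ρ a * ρ b) (y : Y) (x : X) :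
    ‖(cpForm Y ρ).ι (y ⊗ₜ x)‖ ≤ 1 * ‖y‖ * ‖x‖ := by
  refine abs_le_of_sq_le_sq' ?_ (by positivity) |>.2
  rw [norm_sq_eq_rip (B := B), CPTensor.rip_ι_tmul]
  calc _ ≤ ‖x‖ * (‖ρ (rip A y y)‖ * ‖x‖) :=
        (norm_rip_le _ _).trans (by gcongr; exact Adj.norm_apply_le _ _)
    _ ≤ ‖x‖ * (‖rip A y y‖ * ‖x‖) := by
        gcongr
        exact NonUnitalStarAlgHom.norm_apply_le (homOfMul ρ hmul) _
    _ = _ := by rw [← norm_sq_eq_rip (B := A)]; ring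

variable (Y) in
/-- The creation operators `x ↦ y ⊗ x`. -/
def creation (ρ : A →CP Adj B X) (hmul : ∀ a b, ρ (a * b) = ρ a * ρ b) :
    Y →L[ℂ] X →L[ℂ] CPTensor Y ρ :=
  LinearMap.mkContinuous₂ ((TensorProduct.mk ℂ Y X).compr₂ (cpForm Y ρ).ι) 1 (norm_ι_tmul_le hmul)

/-- This is the reduction to generators behind the later uses of nondegeneracy and fullness. -/
lemma mem_of_dense_span {V W : Type*} [NormedAddCommGroup V] [NormedSpace ℂ V]
    [NormedAddCommGroup W] [NormedSpace ℂ W] {s : Set V}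
    (hs : Dense (Submodule.span ℂ s : Set V)) (f : V →L[ℂ] W) {K : Submodule ℂ W}
    (hK : IsClosed (K : Set W)) (h : ∀ v ∈ s, f v ∈ K) (v : V) : f v ∈ K := by
  have h₁ : Submodule.span ℂ s ≤ K.comap f.toLinearMap := Submodule.span_le.2 h
  exact closure_minimal (SetLike.coe_subset_coe.2 h₁) (hK.preimage f.continuous) (hs v)

/-- In effect the creation operator $x\mapsto y\otimes x$ has an adjoint: on $y'\otimes x'$ it is
$\rho(\langle y',y\rangle)^*x'$, and closedness of the representable functionals covers general `z`.
-/
lemma ripCLM_comp_creation_mem (ρ : A →CP Adj B X) (hmul : ∀ a b, ρ (a * b) = ρ a * ρ b)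
    (z : CPTensor Y ρ) (y : Y) : ripCLM B z ∘L creation Y ρ hmul y ∈ ripFunctionals B X := by
  refine (cpForm Y ρ).ind₁ (p := fun z ↦ ripCLM B z ∘L creation Y ρ hmul y ∈ ripFunctionals B X)
    ?_ (fun v ↦ ?_) z
  · exact isClosed_ripFunctionals.preimage
      (isometry_ripCLM.continuous.clm_comp continuous_const)
  · have hadd : ∀ z z' : CPTensor Y ρ, ripCLM B (z + z') = ripCLM B z + ripCLM B z' := fun z z' ↦
      ContinuousLinearMap.ext fun x ↦ rip_add_left z z' x
    induction v with
    | zero => exact ⟨0, ContinuousLinearMap.ext fun x ↦ by simp [rip]⟩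
    | add v w hv hw =>
      rw [map_add, hadd, ContinuousLinearMap.add_comp]
      exact add_mem hv hw
    | tmul y' x' =>
      refine ⟨star (ρ (rip A y' y)) x', ContinuousLinearMap.ext fun x ↦ ?_⟩
      change rip B _ x = rip B _ ((cpForm Y ρ).ι (y ⊗ₜ x))
      rw [Adj.rip_star_left, CPTensor.rip_ι_tmul]

variable {ρ : A →CP Adj B X} {σ : B →CP Adj A Y}

/-- If `Y ⊗_ρ X ≅ B` as correspondences, then every vector of `Y` is represented by a vector
of `X`. -/
lemma exists_rip_eq_of_unitary (hρ : ∀ a b, ρ (a * b) = ρ a * ρ b) (hσ : IsNondegenerate σ)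
    (V : AdjUnitary B (CPTensor Y ρ) B) (hV : ∀ b z, V.toCLM (amp ρ (σ b) z) = b * V.toCLM z)
    (y : Y) : ∃ w : X, ∀ x, rip B w x = V.toCLM ((cpForm Y ρ).ι (y ⊗ₜ x)) := by
  have h := mem_of_dense_span hσ
    ((ContinuousLinearMap.compL ℂ X (CPTensor Y ρ) B V.toCLM) ∘L creation Y ρ hρ)
    isClosed_ripFunctionals ?_ y
  · obtain ⟨w, hw⟩ := h
    exact ⟨w, fun x ↦ congrArg (fun f : X →L[ℂ] B ↦ f x) hw⟩
  -- `B` may lack a unit, hence the passage to vectors `σ b y`: there $V(\sigma(b)y\otimes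
  -- x)=bV(y\otimes x)=\langle V^*(b^*),y\otimes x\rangle$, which is representable.
  · rintro _ ⟨b, y, rfl⟩
    have h := ripCLM_comp_creation_mem ρ hρ (V.adj (star b)) y
    convert h using 1
    refine ContinuousLinearMap.ext fun x ↦ ?_
    change V.toCLM ((cpForm Y ρ).ι (σ b y ⊗ₜ x)) = rip B (V.adj (star b)) _
    rw [← amp_ι_tmul, hV, ← V.rip_toCLM, V.toCLM_adj]
    change _ = star (star b) * _
    rw [star_star]
    rfl

/-- If `w`, `w'` represent `y`, `y'`, then `⟨y, y'⟩` acts by the rank-one operator of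
`w` and `w'`. -/
lemma apply_rip_eq_rankOne (V : AdjUnitary B (CPTensor Y ρ) B) {y y' : Y} {w w' : X}
    (hw : ∀ x, rip B w x = V.toCLM ((cpForm Y ρ).ι (y ⊗ₜ x)))
    (hw' : ∀ x, rip B w' x = V.toCLM ((cpForm Y ρ).ι (y' ⊗ₜ x))) :
    ρ (rip A y y') = Adj.rankOne B w w' := by
  refine Adj.ext fun x' ↦ rip_ext_right (B := B) fun x ↦ ?_
  -- The inner product of $y\otimes x$ and $y'\otimes x'$ is $\langle x,\rho(\langle
  -- y,y'\rangle)x'\rangle$, and through $V$ it is also $\langle w,x\rangle^*\langle w',x'\rangle$.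
  rw [← CPTensor.rip_ι_tmul, ← V.rip_toCLM]
  change star (V.toCLM _) * V.toCLM _ = rip B x (op (rip B w' x') • w)
  rw [← hw, ← hw', star_rip, rip_act_right]

end DualVectors

/-! ### Fullness, compact operators and countable generation -/

section Invertible

variable {A B X Y : Type*}
  [NonUnitalCStarAlgebra A] [PartialOrder A] [StarOrderedRing A]
  [NonUnitalCStarAlgebra B] [PartialOrder B] [StarOrderedRing B]
  [NormedAddCommGroup X] [NormedSpace ℂ X] [SMul Bᵐᵒᵖ X] [CStarModule Bᵐᵒᵖ X] [CompleteSpace X]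
  [NormedAddCommGroup Y] [NormedSpace ℂ Y] [SMul Aᵐᵒᵖ Y] [CStarModule Aᵐᵒᵖ Y] [CompleteSpace Y]

variable (B X) in
/-- The right Hilbert module `X` is full. -/
def IsFull : Prop := Dense (Submodule.span ℂ {b : B | ∃ x y : X, b = rip B x y} : Set B)

/-- On elementary tensors the inner product is $\langle x,\rho(\cdot)x'\rangle$, again an inner
product of two vectors of `X`. -/
lemma rip_mem_of_isClosed {ρ : A →CP Adj B X} {K : Submodule ℂ B} (hK : IsClosed (K : Set B))
    (h : ∀ x x' : X, rip B x x' ∈ K) (z z' : CPTensor Y ρ) : rip B z z' ∈ K := by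
  refine (cpForm Y ρ).ind₂ (p := fun z z' ↦ rip B z z' ∈ K)
    (hK.preimage continuous_rip) (fun v w ↦ ?_) z z'
  induction v with
  | zero =>
    rw [map_zero, ← zero_smul ℂ (0 : CPTensor Y ρ), rip_smul_left, star_zero, zero_smul]
    exact zero_mem _
  | add v₁ v₂ h₁ h₂ => rw [map_add, rip_add_left]; exact add_mem h₁ h₂
  | tmul y x =>
    induction w with
    | zero => rw [map_zero, rip_zero_right]; exact zero_mem _
    | add w₁ w₂ h₁ h₂ => rw [map_add, rip_add_right]; exact add_mem h₁ h₂
    | tmul y' x' => rw [CPTensor.rip_ι_tmul]; exact h _ _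

/-- Every product $ab$ in $B$ is $\langle V^*(a^*),V^*b\rangle$, hence a limit of sums of inner
products of `X`. An approximate unit in place of $a$ recovers $b$. -/
lemma isFull_of_unitary {ρ : A →CP Adj B X} (V : AdjUnitary B (CPTensor Y ρ) B) :
    IsFull B X := by
  intro b
  set K := (Submodule.span ℂ {b : B | ∃ x y : X, b = rip B x y}).topologicalClosure
  have hl := CStarAlgebra.increasingApproximateUnit B
  have := hl.neBot
  refine (Submodule.isClosed_topologicalClosure _).mem_of_tendsto (hl.tendsto_mul_right b)
    (.of_forall fun a ↦ ?_)
  change a * b ∈ K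
  have h : rip B (V.adj (star a)) (V.adj b) = a * b := by
    rw [← V.rip_toCLM, V.toCLM_adj, V.toCLM_adj]
    change star (star a) * b = _
    rw [star_star]
  rw [← h]
  exact rip_mem_of_isClosed (K := K) (Submodule.isClosed_topologicalClosure _)
    (fun x x' ↦ Submodule.le_topologicalClosure _ (Submodule.subset_span ⟨x, x', rfl⟩)) _ _

lemma norm_rankOne_le (x y : X) : ‖Adj.rankOne B x y‖ ≤ ‖x‖ * ‖y‖ :=
  (Adj.rankOneCLM B x y).opNorm_le_bound (by positivity) fun z ↦ by
    refine (norm_op_smul_le (rip B y z) x).trans ?_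
    calc _ ≤ ‖y‖ * ‖z‖ * ‖x‖ := by gcongr; exact norm_rip_le _ _
      _ = _ := by ring

lemma rankOne_apply (x y z : X) : Adj.rankOne B x y z = op (rip B y z) • x := rfl

lemma op_smul_add (b : B) (x y : X) : op b • (x + y) = op b • x + op b • y :=
  (actLin X b).map_add x y

lemma op_smul_smul (b : B) (c : ℂ) (x : X) : op b • c • x = c • op b • x :=
  (actLin X b).map_smul c x

lemma rankOne_add_left (x x' y : X) :
    Adj.rankOne B (x + x') y = Adj.rankOne B x y + Adj.rankOne B x' y :=
  Adj.ext fun _ ↦ op_smul_add _ _ _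

lemma rankOne_add_right (x y y' : X) :
    Adj.rankOne B x (y + y') = Adj.rankOne B x y + Adj.rankOne B x y' :=
  Adj.ext fun z ↦ rip_ext_right (B := B) fun w ↦ by
    simp only [rankOne_apply, Adj.add_apply, rip_add_left, rip_act_right, rip_add_right, mul_add]

lemma rankOne_smul_left (c : ℂ) (x y : X) :
    Adj.rankOne B (c • x) y = c • Adj.rankOne B x y :=
  Adj.ext fun _ ↦ op_smul_smul _ _ _

lemma rankOne_smul_right (c : ℂ) (x y : X) :
    Adj.rankOne B x (c • y) = star c • Adj.rankOne B x y :=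
  Adj.ext fun z ↦ rip_ext_right (B := B) fun w ↦ by
    simp only [rankOne_apply, Adj.smul_apply, rip_smul_left, rip_act_right, rip_smul_right,
      mul_smul_comm]

lemma continuous_rankOne : Continuous fun p : X × X ↦ Adj.rankOne B p.1 p.2 := by
  -- $\Theta_{x,y}$ is conjugate-linear in $y$, so the variables are swapped to place the semilinear
  -- one first.
  let f : X →ₗ⋆[ℂ] X →ₗ[ℂ] Adj B X := LinearMap.mk₂'ₛₗ (starRingEnd ℂ) (.id ℂ)
    (fun y x ↦ Adj.rankOne B x y) (fun y y' x ↦ rankOne_add_right x y y')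
    (fun c y x ↦ rankOne_smul_right c x y) (fun y x x' ↦ rankOne_add_left x x' y)
    (fun c y x ↦ rankOne_smul_left c x y)
  let g : X →L⋆[ℂ] X →L[ℂ] Adj B X := LinearMap.mkContinuous₂ f 1 fun y x ↦ by
    rw [one_mul, mul_comm]
    exact norm_rankOne_le x y
  have : Continuous fun p : X × X ↦ g p.2 p.1 := by fun_prop
  exact this

lemma rankOne_mem_compacts (x y : X) : Adj.rankOne B x y ∈ Adj.compacts B X :=
  Submodule.le_topologicalClosure _ (Submodule.subset_span ⟨x, y, rfl⟩)

/-- A completely positive map as a bounded operator. -/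
def cpCLM (ρ : A →CP Adj B X) : A →L[ℂ] Adj B X := ⟨ρ.toLinearMap, continuous_cp ρ⟩

@[simp] lemma cpCLM_apply (ρ : A →CP Adj B X) (a : A) : cpCLM ρ a = ρ a := rfl

/-- Evaluation of a completely positive map at a vector. -/
def cpEval (ρ : A →CP Adj B X) (x : X) : A →L[ℂ] X :=
  ⟨{ toFun := fun a ↦ ρ a x
     map_add' := fun a b ↦ by rw [map_add, Adj.add_apply]
     map_smul' := fun c a ↦ by rw [map_smul, Adj.smul_apply, RingHom.id_apply] },
    (continuous_adj_apply x).comp (continuous_cp ρ)⟩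

@[simp] lemma cpEval_apply (ρ : A →CP Adj B X) (x : X) (a : A) : cpEval ρ x a = ρ a x := rfl

variable {ρ : A →CP Adj B X} {σ : B →CP Adj A Y}

variable (ρ) in
/-- The vectors of `X` that represent vectors of `Y` under `Y ⊗_ρ X ≅ B`. -/
def representing (V : AdjUnitary B (CPTensor Y ρ) B) : Submodule ℂ X where
  carrier := {w | ∃ y : Y, ∀ x, rip B w x = V.toCLM ((cpForm Y ρ).ι (y ⊗ₜ x))}
  zero_mem' := ⟨0, fun x ↦ by simp [rip]⟩
  add_mem' := by
    rintro w w' ⟨y, h⟩ ⟨y', h'⟩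
    exact ⟨y + y', fun x ↦ by rw [rip_add_left, h, h', TensorProduct.add_tmul, map_add, map_add]⟩
  smul_mem' := by
    rintro c w ⟨y, h⟩
    exact ⟨star c • y, fun x ↦ by
      rw [rip_smul_left, h, ← TensorProduct.smul_tmul', map_smul, map_smul]⟩

/-- If $w$ represents $y$, then $wb$ represents $\sigma(b^*)y$. -/
lemma op_smul_mem_representing {V : AdjUnitary B (CPTensor Y ρ) B}
    (hV : ∀ b z, V.toCLM (amp ρ (σ b) z) = b * V.toCLM z) {w : X}
    (hw : w ∈ representing ρ V) (b : B) : op b • w ∈ representing ρ V := by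
  obtain ⟨y, hy⟩ := hw
  exact ⟨σ (star b) y, fun x ↦ by rw [rip_act_left, hy, ← amp_ι_tmul, hV]⟩

/-- By nondegeneracy and fullness of `Y`, the vectors $\rho(\langle y,y'\rangle)x=w\langle
w',x\rangle$ are total in `X`, and each is a right multiple of a representing vector. -/
lemma dense_representing {V : AdjUnitary B (CPTensor Y ρ) B}
    (hρ : ∀ a b, ρ (a * b) = ρ a * ρ b) (hσ : IsNondegenerate σ) (hρn : IsNondegenerate ρ)
    (hV : ∀ b z, V.toCLM (amp ρ (σ b) z) = b * V.toCLM z) (hY : IsFull A Y) :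
    Dense (representing ρ V : Set X) := by
  have hcl := Submodule.isClosed_topologicalClosure (representing ρ V)
  refine fun x ↦ mem_of_dense_span (K := (representing ρ V).topologicalClosure) hρn
    (.id ℂ X) hcl ?_ x
  rintro _ ⟨a, x, rfl⟩
  refine mem_of_dense_span hY (cpEval ρ x) hcl ?_ a
  rintro _ ⟨y, y', rfl⟩
  obtain ⟨w, hw⟩ := exists_rip_eq_of_unitary hρ hσ V hV y
  obtain ⟨w', hw'⟩ := exists_rip_eq_of_unitary hρ hσ V hV y'
  rw [cpEval_apply, apply_rip_eq_rankOne V hw hw']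
  exact Submodule.le_topologicalClosure _ (op_smul_mem_representing hV ⟨y, hw⟩ _)

/-- Fullness of `Y` reduces one inclusion to $\rho(\langle y,y'\rangle)=\Theta_{w,w'}$. For the
other, `ρ` is isometric, so its range is closed; it contains $\Theta_{w,w'}$ for representing
vectors, and these are dense. -/
lemma range_eq_compacts {V : AdjUnitary B (CPTensor Y ρ) B}
    (hρ : ∀ a b, ρ (a * b) = ρ a * ρ b) (hinj : Function.Injective ρ)
    (hσ : IsNondegenerate σ) (hρn : IsNondegenerate ρ)
    (hV : ∀ b z, V.toCLM (amp ρ (σ b) z) = b * V.toCLM z) (hY : IsFull A Y) :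
    Set.range ρ = (Adj.compacts B X : Set (Adj B X)) := by
  refine Set.Subset.antisymm ?_ ?_
  · rintro _ ⟨a, rfl⟩
    refine mem_of_dense_span hY (cpCLM ρ) (Submodule.isClosed_topologicalClosure _) ?_ a
    rintro _ ⟨y, y', rfl⟩
    obtain ⟨w, hw⟩ := exists_rip_eq_of_unitary hρ hσ V hV y
    obtain ⟨w', hw'⟩ := exists_rip_eq_of_unitary hρ hσ V hV y'
    rw [cpCLM_apply, apply_rip_eq_rankOne V hw hw']
    exact rankOne_mem_compacts w w'
  · have hcl : IsClosed (Set.range ρ) :=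
      (NonUnitalStarAlgHom.isometry (homOfMul ρ hρ) hinj).isClosedEmbedding.isClosed_range
    have hd := dense_representing hρ hσ hρn hV hY
    have h₁ : ∀ x x' : X, Adj.rankOne B x x' ∈ Set.range ρ := fun x x' ↦ by
      have h₂ : closure ((representing ρ V : Set X) ×ˢ (representing ρ V : Set X)) ⊆
          (fun p : X × X ↦ Adj.rankOne B p.1 p.2) ⁻¹' Set.range ρ := by
        refine closure_minimal ?_ (hcl.preimage continuous_rankOne)
        rintro ⟨w, w'⟩ ⟨⟨y, hy⟩, ⟨y', hy'⟩⟩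
        exact ⟨_, apply_rip_eq_rankOne V hy hy'⟩
      exact h₂ (a := (x, x')) ((hd.prod hd) _)
    have h₃ : Submodule.span ℂ {T | ∃ x y : X, T = Adj.rankOne B x y} ≤
        LinearMap.range ρ.toLinearMap := by
      rw [Submodule.span_le]
      rintro _ ⟨x, x', rfl⟩
      exact h₁ x x'
    exact closure_minimal (SetLike.coe_subset_coe.2 h₃) hcl

/-- In a separable space, a set with dense linear span contains a countable set with dense linear
span. -/
lemma exists_countable_dense_span {V : Type*} [NormedAddCommGroup V] [NormedSpace ℂ V]
    [TopologicalSpace.SeparableSpace V] {s : Set V} (hs : Dense (Submodule.span ℂ s : Set V)) :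
    ∃ t ⊆ s, t.Countable ∧ Dense (Submodule.span ℂ t : Set V) := by
  have := UniformSpace.secondCountable_of_separable V
  obtain ⟨d, hds, hdc, hd⟩ := hs.exists_countable_dense_subset
  choose f hfs hf using fun v : d ↦ Submodule.mem_span_finite_of_mem_span (hds v.2)
  have := hdc.to_subtype
  refine ⟨⋃ v : d, (f v : Set V), Set.iUnion_subset hfs,
    Set.countable_iUnion fun v ↦ (f v).countable_toSet, hd.mono fun v hv ↦ ?_⟩
  exact Submodule.span_mono (Set.subset_iUnion (fun v : d ↦ (f v : Set V)) ⟨v, hv⟩) (hf ⟨v, hv⟩)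

/-- Separability lets countably many $\langle y,y'\rangle$ span a dense subspace of $A$. Each acts
as some $\Theta_{w,w'}$ with image in $wB$, so by nondegeneracy these countably many $w$ generate
`X`. -/
lemma countably_generated_of_unitary [TopologicalSpace.SeparableSpace A]
    {V : AdjUnitary B (CPTensor Y ρ) B} (hρ : ∀ a b, ρ (a * b) = ρ a * ρ b)
    (hσ : IsNondegenerate σ) (hρn : IsNondegenerate ρ)
    (hV : ∀ b z, V.toCLM (amp ρ (σ b) z) = b * V.toCLM z) (hY : IsFull A Y) :
    ∃ s : Set X, s.Countable ∧
      Dense (Submodule.span ℂ {z : X | ∃ x ∈ s, ∃ b : B, z = op b • x} : Set X) := by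
  obtain ⟨t, hts, htc, ht⟩ := exists_countable_dense_span hY
  have h : ∀ a : t, ∃ w w' : X, ρ a = Adj.rankOne B w w' := by
    rintro ⟨a, ha⟩
    obtain ⟨y, y', rfl⟩ := hts ha
    obtain ⟨w, hw⟩ := exists_rip_eq_of_unitary hρ hσ V hV y
    obtain ⟨w', hw'⟩ := exists_rip_eq_of_unitary hρ hσ V hV y'
    exact ⟨w, w', apply_rip_eq_rankOne V hw hw'⟩
  choose w w' hw using h
  have := htc.to_subtype
  refine ⟨Set.range w, Set.countable_range w, fun x ↦ ?_⟩
  set K := Submodule.span ℂ {z : X | ∃ x ∈ Set.range w, ∃ b : B, z = op b • x}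
  refine mem_of_dense_span (K := K.topologicalClosure) hρn (.id ℂ X)
    (Submodule.isClosed_topologicalClosure _) ?_ x
  rintro _ ⟨a, x, rfl⟩
  refine mem_of_dense_span ht (cpEval ρ x) (Submodule.isClosed_topologicalClosure _) ?_ a
  intro a ha
  refine Submodule.le_topologicalClosure _ (Submodule.subset_span ⟨w ⟨a, ha⟩, ⟨_, rfl⟩, ?_⟩)
  exact ⟨rip B (w' ⟨a, ha⟩) x, by rw [cpEval_apply, hw ⟨a, ha⟩]; rfl⟩

end Invertible

/-! ### Invertible morphisms come from Morita bimodules -/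

section

variable {A B : Type u}
  [NonUnitalCStarAlgebra A] [PartialOrder A] [StarOrderedRing A]
  [NonUnitalCStarAlgebra B] [PartialOrder B] [StarOrderedRing B]

/-- Each composite gives faithfulness of its first factor, and this is what the other composite
needs to yield multiplicativity and nondegeneracy. Afterwards `U` gives fullness of `Q.X`, while `V`
gives fullness of `P.X` and the representing vectors. -/
lemma Hom.IsInvertible.exists_isMorita [TopologicalSpace.SeparableSpace A] {m : Hom A B}
    (hm : m.IsInvertible) : ∃ M : Correspondence A B, M.IsMorita ∧ m.IsClassOf M := by
  obtain ⟨n, h₁, h₂⟩ := hm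
  obtain ⟨P, rfl⟩ := Quotient.exists_rep m
  obtain ⟨Q, rfl⟩ := Quotient.exists_rep n
  have h₁ : (P.comp Q).toPosCorr.Iso (StrictPosCorr.id A).toPosCorr := Quotient.exact h₁
  have h₂ : (Q.comp P).toPosCorr.Iso (StrictPosCorr.id B).toPosCorr := Quotient.exact h₂
  have hP₀ := eq_zero_of_comp_iso_id h₁
  have hQ₀ := eq_zero_of_comp_iso_id h₂
  have hP := map_mul_of_comp_iso_id h₁ hQ₀
  have hQ := map_mul_of_comp_iso_id h₂ hP₀
  have hPn := isNondegenerate_of_comp_iso_id h₁ hQ₀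
  have hQn := isNondegenerate_of_comp_iso_id h₂ hP₀
  obtain ⟨U, hU⟩ := (comp_iso_id_iff hQ hQn).1 h₁
  obtain ⟨V, hV⟩ := (comp_iso_id_iff hP hPn).1 h₂
  have hY := isFull_of_unitary U
  have hinj : Function.Injective P.ρ := (injective_iff_map_eq_zero _).2 hP₀
  have hr := range_eq_compacts hP hinj hQn hPn hV hY
  let M : Correspondence A B :=
    { X := P.X
      countably_generated := countably_generated_of_unitary hP hQn hPn hV hY
      φ := homOfMul P.ρ hP }
  exact ⟨M, ⟨hinj, fun a ↦ hr.subset ⟨a, rfl⟩, isFull_of_unitary V, hr⟩, P.strict,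
    Quotient.sound ⟨.refl, fun _ _ ↦ rfl⟩⟩

end

/-! ### Calculus of rank-one operators -/

section RankOne

variable {B X : Type*} [NonUnitalCStarAlgebra B] [PartialOrder B] [StarOrderedRing B]
  [NormedAddCommGroup X] [NormedSpace ℂ X] [SMul Bᵐᵒᵖ X] [CStarModule Bᵐᵒᵖ X] [CompleteSpace X]

lemma star_rankOne (x y : X) : star (Adj.rankOne B x y) = Adj.rankOne B y x :=
  Adj.ext fun z ↦ rip_ext_right (B := B) fun w ↦ by
    rw [Adj.rip_star_right, rankOne_apply, rankOne_apply, rip_act_left, rip_act_right, star_rip]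

lemma mul_rankOne (T : Adj B X) (x y : X) :
    T * Adj.rankOne B x y = Adj.rankOne B (T x) y :=
  Adj.ext fun z ↦ rip_ext_right (B := B) fun w ↦ by
    rw [Adj.mul_apply, rankOne_apply, rankOne_apply, rip_act_right, ← Adj.rip_star_left,
      rip_act_right, Adj.rip_star_left]

lemma rankOne_mul (T : Adj B X) (x y : X) :
    Adj.rankOne B x y * T = Adj.rankOne B x (star T y) :=
  Adj.ext fun z ↦ by
    rw [Adj.mul_apply, rankOne_apply, rankOne_apply, Adj.rip_star_left]

lemma rankOne_act_left (b : B) (x y : X) :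
    Adj.rankOne B (op b • x) y = Adj.rankOne B x (op (star b) • y) :=
  Adj.ext fun z ↦ rip_ext_right (B := B) fun w ↦ by
    simp only [rankOne_apply, rip_act_left, rip_act_right, star_star, mul_assoc]

/-- For the lower bound, $\langle x,\Theta_{x,x}x\rangle=\langle x,x\rangle^2$ has norm $\|x\|^4$.
-/
lemma norm_rankOne_self (x : X) : ‖Adj.rankOne B x x‖ = ‖x‖ ^ 2 := by
  refine le_antisymm ((norm_rankOne_le x x).trans_eq (sq _).symm) ?_
  rcases (norm_nonneg x).eq_or_lt with h₀ | h₀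
  · rw [← h₀]
    simp
  · have h₁ : ‖rip B x (Adj.rankOne B x x x)‖ ≤ ‖x‖ * (‖Adj.rankOne B x x‖ * ‖x‖) :=
      (norm_rip_le _ _).trans (by gcongr; exact Adj.norm_apply_le _ _)
    have h₂ : ‖rip B x (Adj.rankOne B x x x)‖ = (‖x‖ ^ 2) * ‖x‖ ^ 2 := by
      rw [rankOne_apply, rip_act_right]
      nth_rewrite 1 [← star_rip]
      rw [CStarRing.norm_star_mul_self, ← norm_sq_eq_rip]
    rw [h₂] at h₁
    refine le_of_mul_le_mul_right ?_ (show 0 < ‖x‖ ^ 2 by positivity)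
    linarith

variable (B) in
/-- The map `b ↦ x b`. -/
def actCLM (x : X) : B →L[ℂ] X :=
  LinearMap.mkContinuous
    { toFun := fun b ↦ op b • x
      map_add' := fun b b' ↦ rip_ext_right (B := B) fun w ↦ by
        simp only [rip_act_right, rip_add_right, mul_add]
      map_smul' := fun c b ↦ rip_ext_right (B := B) fun w ↦ by
        simp only [rip_act_right, rip_smul_right, mul_smul_comm, RingHom.id_apply] }
    ‖x‖ fun b ↦ (norm_op_smul_le b x).trans_eq (mul_comm _ _)

lemma mem_closure_act (x : X) : x ∈ closure (Set.range fun b : B ↦ op b • x) := by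
  have hl := CStarAlgebra.increasingApproximateUnit B
  have := hl.neBot
  exact mem_closure_of_tendsto (tendsto_act hl x) (.of_forall fun b ↦ ⟨b, rfl⟩)

/-- An injective `*`-homomorphism to the adjointable operators reflects positivity. -/
lemma nonneg_of_rip_apply_nonneg {A : Type*} [NonUnitalCStarAlgebra A] [PartialOrder A]
    [StarOrderedRing A] (φ : A →⋆ₙₐ[ℂ] Adj B X) (hφ : Function.Injective φ) {a : A}
    (ha : IsSelfAdjoint a) (h : ∀ x, 0 ≤ rip B x (φ a x)) : 0 ≤ a := by
  obtain ⟨P, N, hP, hN, hNP, rfl⟩ := exists_sub_of_isSelfAdjoint ha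
  have hNs : star N = N := (IsSelfAdjoint.of_nonneg hN).star_eq
  -- Compressing $P-N$ by $N$ gives $-N^3=-R^*R$. Positivity of the form at the vectors
  -- $\varphi(N)x$ then forces $\varphi(R)=0$.
  obtain ⟨R, hR⟩ := exists_eq_star_mul_self (star_left_conjugate_nonneg hN N)
  have hR₀ : φ R = 0 := Adj.ext fun x ↦ by
    have h₁ := h (φ N x)
    have h₂ : star N * (P - N) * N = -(star R * R) := by
      rw [← hR, mul_sub, sub_mul, hNs, hNP, zero_mul, zero_sub]
    have h₃ : rip B (φ N x) (φ (P - N) (φ N x)) = -rip B (φ R x) (φ R x) := by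
      calc _ = rip B x (φ (star N * (P - N) * N) x) := by
            rw [map_mul, map_mul, map_star, Adj.mul_apply, Adj.mul_apply, Adj.rip_star_right]
        _ = rip B x (0 - φ (star R * R) x) := by rw [h₂, map_neg, zero_sub]; rfl
        _ = _ := by
            rw [rip_sub_right, rip_zero_right, zero_sub, map_mul, map_star, Adj.mul_apply,
              Adj.rip_star_right]
    rw [h₃] at h₁
    rw [Adj.zero_apply, ← rip_self_eq_zero (B := B)]
    exact le_antisymm (neg_nonneg.1 h₁) (rip_self_nonneg _)
  rw [(injective_iff_map_eq_zero φ).1 hφ R hR₀, mul_zero, hNs] at hR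
  -- $N^3=0$ gives $N^4=0$, and two uses of the C⋆-identity give $N=0$.
  have hNN : star (star N * N) * (star N * N) = 0 := by
    rw [star_mul, star_star, hNs, ← mul_assoc, hR, zero_mul]
  rw [CStarRing.star_mul_self_eq_zero_iff, CStarRing.star_mul_self_eq_zero_iff] at hNN
  rwa [hNN, sub_zero]

end RankOne

/-! ### The conjugate module as inverse of a Morita bimodule -/

namespace Correspondence.IsMorita

variable {A B : Type u}
  [NonUnitalCStarAlgebra A] [PartialOrder A] [StarOrderedRing A]
  [NonUnitalCStarAlgebra B] [PartialOrder B] [StarOrderedRing B]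
  {M : Correspondence A B} (hM : M.IsMorita)

lemma exists_eq_rankOne (hM : M.IsMorita) (x y : M.X) : ∃ a, M.φ a = Adj.rankOne B x y :=
  hM.range_eq.superset (rankOne_mem_compacts x y)

/-- The `A`-valued inner product of a Morita equivalence bimodule, linear in the first variable. -/
def lip (x y : M.X) : A := (hM.exists_eq_rankOne x y).choose

@[simp] lemma φ_lip (x y : M.X) : M.φ (hM.lip x y) = Adj.rankOne B x y :=
  (hM.exists_eq_rankOne x y).choose_spec

/-- This and the following algebraic rules are identities between rank-one operators, pulled back
along the injective `M.φ`. -/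
lemma star_lip (x y : M.X) : star (hM.lip x y) = hM.lip y x :=
  hM.injective (by rw [map_star, φ_lip, φ_lip, star_rankOne])

lemma lip_add_left (x x' y : M.X) : hM.lip (x + x') y = hM.lip x y + hM.lip x' y :=
  hM.injective (by simp only [map_add, φ_lip, rankOne_add_left])

lemma lip_add_right (x y y' : M.X) : hM.lip x (y + y') = hM.lip x y + hM.lip x y' :=
  hM.injective (by simp only [map_add, φ_lip, rankOne_add_right])

lemma lip_smul_left (c : ℂ) (x y : M.X) : hM.lip (c • x) y = c • hM.lip x y :=
  hM.injective (by simp only [map_smul, φ_lip, rankOne_smul_left])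

lemma lip_smul_right (c : ℂ) (x y : M.X) : hM.lip x (c • y) = star c • hM.lip x y :=
  hM.injective (by simp only [map_smul, φ_lip, rankOne_smul_right])

lemma lip_φ_left (a : A) (x y : M.X) : hM.lip (M.φ a x) y = a * hM.lip x y :=
  hM.injective (by simp only [map_mul, φ_lip, mul_rankOne])

lemma lip_φ_right (a : A) (x y : M.X) : hM.lip x (M.φ a y) = hM.lip x y * star a :=
  hM.injective (by simp only [map_mul, φ_lip, rankOne_mul, map_star, star_star])

lemma lip_act_left (b : B) (x y : M.X) : hM.lip (op b • x) y = hM.lip x (op (star b) • y) :=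
  hM.injective (by simp only [φ_lip, rankOne_act_left])

/-- Thus the conjugate module can keep the norm of `M.X` and needs no completion. -/
lemma norm_lip_self (x : M.X) : ‖hM.lip x x‖ = ‖x‖ ^ 2 := by
  rw [← NonUnitalStarAlgHom.norm_map M.φ hM.injective, φ_lip, norm_rankOne_self]

/-- The form $\langle z,\Theta_{x,x}z\rangle=\langle x,z\rangle^*\langle x,z\rangle$ is positive,
and an injective `*`-homomorphism reflects positivity. -/
lemma lip_self_nonneg (x : M.X) : 0 ≤ hM.lip x x := by
  refine nonneg_of_rip_apply_nonneg M.φ hM.injective (hM.star_lip x x) fun z ↦ ?_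
  rw [φ_lip, rankOne_apply, rip_act_right, ← star_rip (B := B) x z]
  exact star_mul_self_nonneg _

lemma lip_mul_lip (x y x' y' : M.X) :
    hM.lip x y * hM.lip x' y' = hM.lip x (op (rip B x' y) • y') :=
  hM.injective (by
    simp only [map_mul, φ_lip, rankOne_mul, star_rankOne, rankOne_apply])

/-- `M.φ` is a topological embedding into the compacts, where the rank-one operators, images of the
elements `hM.lip x y`, span a dense subspace. -/
lemma dense_span_lip : Dense (Submodule.span ℂ {a | ∃ x y : M.X, a = hM.lip x y} : Set A) := by
  intro a
  have hi := (NonUnitalStarAlgHom.isometry M.φ hM.injective).isEmbedding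
  rw [hi.isInducing.closure_eq_preimage_closure_image]
  have h : M.φ a ∈ closure
      (Submodule.span ℂ {T | ∃ x y : M.X, T = Adj.rankOne B x y} : Set (Adj B M.X)) :=
    hM.compact a
  refine closure_mono ?_ h
  have h' : Submodule.span ℂ {T | ∃ x y : M.X, T = Adj.rankOne B x y} ≤
      (Submodule.span ℂ {a | ∃ x y : M.X, a = hM.lip x y}).map (homCP M.φ).toLinearMap := by
    rw [Submodule.span_le]
    rintro _ ⟨x, y, rfl⟩
    exact ⟨hM.lip x y, Submodule.subset_span ⟨x, y, rfl⟩, hM.φ_lip x y⟩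
  exact h'

/-- A vector $x$ is a limit of vectors $xb$; fullness approximates $b$ by sums of $\langle
y,z\rangle$, and $x\langle y,z\rangle=\phi(\langle x,y\rangle_A)z$. -/
lemma isNondegenerate (hM : M.IsMorita) : IsNondegenerate (homCP M.φ) := by
  intro x
  set K := (Submodule.span ℂ {z : M.X | ∃ a x, z = homCP M.φ a x}).topologicalClosure
  have hcl : IsClosed (K : Set M.X) := Submodule.isClosed_topologicalClosure _
  refine closure_minimal ?_ hcl (mem_closure_act (B := B) x)
  rintro _ ⟨b, rfl⟩
  refine mem_of_dense_span hM.full (actCLM B x) hcl ?_ b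
  rintro _ ⟨y, z, rfl⟩
  refine Submodule.le_topologicalClosure _ (Submodule.subset_span ⟨hM.lip x y, z, ?_⟩)
  rw [homCP_apply, φ_lip]
  rfl

lemma isStrict (hM : M.IsMorita) : IsStrict M.toPosCorr.ρ :=
  hM.isNondegenerate.isStrict (map_mul M.φ)

/-- The conjugate module of a Morita equivalence bimodule. -/
def Dual (_ : M.IsMorita) : Type u := M.X

instance : NormedAddCommGroup hM.Dual := inferInstanceAs (NormedAddCommGroup M.X)
instance : CompleteSpace hM.Dual := inferInstanceAs (CompleteSpace M.X)
instance : Module ℂ hM.Dual := Module.compHom M.X (starRingEnd ℂ)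

/-- The conjugate-linear identification of `X` with the conjugate module. -/
def toDual : M.X ≃+ hM.Dual := AddEquiv.refl M.X

lemma norm_toDual (x : M.X) : ‖hM.toDual x‖ = ‖x‖ := rfl

lemma smul_toDual (c : ℂ) (x : M.X) : c • hM.toDual x = hM.toDual (star c • x) := rfl

instance : NormedSpace ℂ hM.Dual where
  norm_smul_le c x := by
    obtain ⟨x, rfl⟩ := hM.toDual.surjective x
    rw [smul_toDual, norm_toDual, norm_toDual, norm_smul, norm_star]

instance : SMul Aᵐᵒᵖ hM.Dual := ⟨fun a x ↦ hM.toDual (M.φ (star a.unop) (hM.toDual.symm x))⟩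

lemma act_toDual (a : A) (x : M.X) : op a • hM.toDual x = hM.toDual (M.φ (star a) x) := rfl

instance : CStarModule Aᵐᵒᵖ hM.Dual where
  inner x y := op (hM.lip (hM.toDual.symm x) (hM.toDual.symm y))
  inner_add_right {x y z} := by rw [map_add, lip_add_right, op_add]
  inner_self_nonneg {x} := hM.lip_self_nonneg (hM.toDual.symm x)
  inner_self {x} := by
    rw [op_eq_zero_iff, ← norm_eq_zero, norm_lip_self, sq_eq_zero_iff, norm_eq_zero,
      map_eq_zero_iff _ hM.toDual.symm.injective]
  inner_op_smul_right {a x y} := by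
    obtain ⟨a, rfl⟩ := op_surjective a
    obtain ⟨y, rfl⟩ := hM.toDual.surjective y
    rw [act_toDual, AddEquiv.symm_apply_apply, AddEquiv.symm_apply_apply, lip_φ_right, star_star,
      op_mul]
  inner_smul_right_complex {c x y} := by
    obtain ⟨y, rfl⟩ := hM.toDual.surjective y
    rw [smul_toDual, AddEquiv.symm_apply_apply, AddEquiv.symm_apply_apply, lip_smul_right,
      star_star, op_smul]
  star_inner x y := by rw [← op_star, star_lip]
  norm_eq_sqrt_norm_inner_self x := by
    obtain ⟨x, rfl⟩ := hM.toDual.surjective x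
    rw [norm_op, AddEquiv.symm_apply_apply, norm_lip_self, norm_toDual,
      Real.sqrt_sq (norm_nonneg _)]

@[simp] lemma rip_toDual (x y : M.X) : rip A (hM.toDual x) (hM.toDual y) = hM.lip x y := rfl

/-- The operator `x̃ ↦ (x b*)~` on the conjugate module. -/
def dualActCLM (b : B) : hM.Dual →L[ℂ] hM.Dual :=
  LinearMap.mkContinuous
    { toFun := fun x ↦ hM.toDual (op (star b) • hM.toDual.symm x)
      map_add' := fun x y ↦ by rw [map_add, op_smul_add, map_add]
      map_smul' := fun c x ↦ by
        obtain ⟨x, rfl⟩ := hM.toDual.surjective x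
        rw [smul_toDual, AddEquiv.symm_apply_apply, AddEquiv.symm_apply_apply, op_smul_smul,
          RingHom.id_apply, smul_toDual] }
    ‖b‖ fun x ↦ by
      rw [← norm_star b]
      exact norm_op_smul_le (star b) (hM.toDual.symm x)

lemma dualActCLM_toDual (b : B) (x : M.X) :
    hM.dualActCLM b (hM.toDual x) = hM.toDual (op (star b) • x) := rfl

lemma rip_dualActCLM (b : B) (x y : hM.Dual) :
    rip A (hM.dualActCLM b x) y = rip A x (hM.dualActCLM (star b) y) := by
  obtain ⟨x, rfl⟩ := hM.toDual.surjective x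
  obtain ⟨y, rfl⟩ := hM.toDual.surjective y
  rw [dualActCLM_toDual, dualActCLM_toDual, rip_toDual, rip_toDual, lip_act_left]

/-- The left action of `B` on the conjugate module. -/
def dualAct : B →⋆ₙₐ[ℂ] Adj A hM.Dual where
  toFun b := Adj.mk (hM.dualActCLM b) (hM.dualActCLM (star b)) (hM.rip_dualActCLM b)
  map_smul' c b := Adj.ext fun x ↦ by
    obtain ⟨x, rfl⟩ := hM.toDual.surjective x
    rw [Adj.smul_apply]
    simp only [Adj.mk_apply, dualActCLM_toDual, smul_toDual, MonoidHom.id_apply]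
    rw [star_smul]
    exact congrArg hM.toDual (map_smul (actCLM B x) (star c) (star b))
  map_zero' := Adj.ext fun x ↦ by
    obtain ⟨x, rfl⟩ := hM.toDual.surjective x
    rw [Adj.zero_apply, Adj.mk_apply, dualActCLM_toDual, star_zero]
    exact congrArg hM.toDual (map_zero (actCLM B x))
  map_add' b b' := Adj.ext fun x ↦ by
    obtain ⟨x, rfl⟩ := hM.toDual.surjective x
    rw [Adj.add_apply]
    simp only [Adj.mk_apply, dualActCLM_toDual, star_add, ← map_add]
    exact congrArg hM.toDual (map_add (actCLM B x) (star b) (star b'))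
  map_mul' b b' := Adj.ext fun x ↦ by
    obtain ⟨x, rfl⟩ := hM.toDual.surjective x
    rw [Adj.mul_apply]
    simp only [Adj.mk_apply, dualActCLM_toDual, star_mul]
    refine congrArg hM.toDual (rip_ext_right (B := B) fun w ↦ ?_)
    simp only [rip_act_right, mul_assoc]
  map_star' b := Adj.ext fun x ↦ rip_ext_right (B := A) fun w ↦ by
    rw [Adj.rip_star_right]
    exact (hM.rip_dualActCLM b w x).symm

@[simp] lemma dualAct_toDual (b : B) (x : M.X) :
    hM.dualAct b (hM.toDual x) = hM.toDual (op (star b) • x) := rfl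

lemma isNondegenerate_dualAct : IsNondegenerate (homCP hM.dualAct) := by
  intro x
  obtain ⟨x, rfl⟩ := hM.toDual.surjective x
  have h : hM.toDual x ∈ closure (Set.range fun b : B ↦ hM.toDual (op b • x)) :=
    mem_closure_act (B := B) x
  refine closure_mono ?_ h
  rintro _ ⟨b, rfl⟩
  refine Submodule.subset_span ⟨star b, hM.toDual x, ?_⟩
  rw [homCP_apply, dualAct_toDual, star_star]

/-- The conjugate module as a strict positive correspondence. -/
def dualCorr : StrictPosCorr B A where
  X := hM.Dual
  ρ := homCP hM.dualAct
  strict := hM.isNondegenerate_dualAct.isStrict (map_mul hM.dualAct)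

/-- The unitary `X ⊗_B X̃ ≅ A`, `x ⊗ ỹ ↦ ⟨x, y⟩_A`. -/
def tensorDualUnitary : AdjUnitary A (CPTensor M.X (homCP hM.dualAct)) A :=
  CPTensor.unitary
    (LinearMap.mk₂ ℂ (fun x y ↦ hM.lip x (hM.toDual.symm y))
      (fun x x' y ↦ hM.lip_add_left x x' _)
      (fun c x y ↦ hM.lip_smul_left c x _)
      (fun x y y' ↦ by rw [map_add, lip_add_right])
      (fun c x y ↦ by
        obtain ⟨y, rfl⟩ := hM.toDual.surjective y
        rw [smul_toDual, AddEquiv.symm_apply_apply, AddEquiv.symm_apply_apply, lip_smul_right,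
          star_star]))
    (fun x y x' y' ↦ by
      obtain ⟨y, rfl⟩ := hM.toDual.surjective y
      obtain ⟨y', rfl⟩ := hM.toDual.surjective y'
      -- $\langle x,y\rangle_A^*\langle x',y'\rangle_A=\langle y,x\rangle_A\langle
      -- x',y'\rangle_A=\langle y,y'\langle x',x\rangle_B\rangle_A$, and $y'\langle x',x\rangle_B$
      -- is $\langle x,x'\rangle_B$ acting on $\tilde y'$.
      change star (hM.lip x y) * hM.lip x' y' = _
      rw [star_lip, lip_mul_lip, homCP_apply, dualAct_toDual, rip_toDual, star_rip])
    (by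
      refine hM.dense_span_lip.mono (Submodule.span_mono ?_)
      rintro _ ⟨x, y, rfl⟩
      exact ⟨x, hM.toDual y, rfl⟩)

lemma tensorDualUnitary_ι_tmul (x y : M.X) :
    hM.tensorDualUnitary.toCLM ((cpForm M.X (homCP hM.dualAct)).ι (x ⊗ₜ hM.toDual y)) =
      hM.lip x y :=
  CPTensor.unitary_ι_tmul ..

/-- The unitary `X̃ ⊗_A X ≅ B`, `x̃ ⊗ y ↦ ⟨x, y⟩_B`. -/
def dualTensorUnitary : AdjUnitary B (CPTensor hM.Dual (homCP M.φ)) B :=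
  CPTensor.unitary
    (LinearMap.mk₂ ℂ (fun x y ↦ rip B (hM.toDual.symm x) y)
      (fun x x' y ↦ by rw [map_add, rip_add_left])
      (fun c x y ↦ by
        obtain ⟨x, rfl⟩ := hM.toDual.surjective x
        rw [smul_toDual, AddEquiv.symm_apply_apply, AddEquiv.symm_apply_apply, rip_smul_left,
          star_star])
      (fun x y y' ↦ rip_add_right _ y y')
      (fun c x y ↦ rip_smul_right c _ y))
    (fun x y x' y' ↦ by
      obtain ⟨x, rfl⟩ := hM.toDual.surjective x
      obtain ⟨x', rfl⟩ := hM.toDual.surjective x'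
      -- $\langle y,x\rangle_B\langle x',y'\rangle_B=\langle y,\Theta_{x,x'}y'\rangle_B$, and
      -- $\Theta_{x,x'}=\phi(\langle x,x'\rangle_A)$.
      change star (rip B x y) * rip B x' y' = _
      rw [star_rip, homCP_apply, rip_toDual, φ_lip, rankOne_apply, rip_act_right])
    (by
      refine hM.full.mono (Submodule.span_mono ?_)
      rintro _ ⟨x, y, rfl⟩
      exact ⟨hM.toDual x, y, rfl⟩)

lemma dualTensorUnitary_ι_tmul (x y : M.X) :
    hM.dualTensorUnitary.toCLM ((cpForm hM.Dual (homCP M.φ)).ι (hM.toDual x ⊗ₜ y)) =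
      rip B x y :=
  CPTensor.unitary_ι_tmul ..

lemma tensorDualUnitary_amp (a : A) (z : CPTensor M.X (homCP hM.dualAct)) :
    hM.tensorDualUnitary.toCLM (amp (homCP hM.dualAct) (M.φ a) z) =
      a * hM.tensorDualUnitary.toCLM z := by
  refine CPTensor.ext_ι_tmul
    (f := hM.tensorDualUnitary.toCLM ∘L (amp (homCP hM.dualAct) (M.φ a)).toCLM)
    (g := ContinuousLinearMap.mul ℂ A a ∘L hM.tensorDualUnitary.toCLM) (fun x y ↦ ?_) z
  obtain ⟨y, rfl⟩ := hM.toDual.surjective y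
  change hM.tensorDualUnitary.toCLM (amp (homCP hM.dualAct) (M.φ a) _) =
    a * hM.tensorDualUnitary.toCLM _
  rw [amp_ι_tmul, tensorDualUnitary_ι_tmul, tensorDualUnitary_ι_tmul, lip_φ_left]

lemma dualTensorUnitary_amp (b : B) (z : CPTensor hM.Dual (homCP M.φ)) :
    hM.dualTensorUnitary.toCLM (amp (homCP M.φ) (hM.dualAct b) z) =
      b * hM.dualTensorUnitary.toCLM z := by
  refine CPTensor.ext_ι_tmul
    (f := hM.dualTensorUnitary.toCLM ∘L (amp (homCP M.φ) (hM.dualAct b)).toCLM)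
    (g := ContinuousLinearMap.mul ℂ B b ∘L hM.dualTensorUnitary.toCLM) (fun x y ↦ ?_) z
  obtain ⟨x, rfl⟩ := hM.toDual.surjective x
  change hM.dualTensorUnitary.toCLM (amp (homCP M.φ) (hM.dualAct b) _) =
    b * hM.dualTensorUnitary.toCLM _
  rw [amp_ι_tmul, dualAct_toDual, dualTensorUnitary_ι_tmul, dualTensorUnitary_ι_tmul,
    rip_act_left, star_star]

/-- Both left actions are nondegenerate `*`-homomorphisms, so the KSGNS modules drop out and the two
explicit unitaries suffice. -/
lemma isInvertible (hM : M.IsMorita) {m : Hom A B} (hm : m.IsClassOf M) : m.IsInvertible := by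
  obtain ⟨h, rfl⟩ := hm
  exact ⟨Hom.mk hM.dualCorr,
    Quotient.sound ((comp_iso_id_iff (Q := hM.dualCorr) (map_mul hM.dualAct)
      hM.isNondegenerate_dualAct).2 ⟨hM.tensorDualUnitary, hM.tensorDualUnitary_amp⟩),
    Quotient.sound ((comp_iso_id_iff (P := hM.dualCorr) (Q := ⟨M.toPosCorr, h⟩) (map_mul M.φ)
      hM.isNondegenerate).2 ⟨hM.dualTensorUnitary, hM.dualTensorUnitary_amp⟩)⟩

end Correspondence.IsMorita

end

end Quesadilla

theorem mainTheorem4 {A B : Type u}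
    [NonUnitalCStarAlgebra A] [PartialOrder A] [StarOrderedRing A]
    [TopologicalSpace.SeparableSpace A]
    [NonUnitalCStarAlgebra B] [PartialOrder B] [StarOrderedRing B]
    [TopologicalSpace.SeparableSpace B] :
    (∀ M : Quesadilla.Correspondence A B, M.IsMorita →
      ∃ m : Quesadilla.Hom A B, m.IsClassOf M) ∧
    ∀ m : Quesadilla.Hom A B, m.IsInvertible ↔
      ∃ M : Quesadilla.Correspondence A B, M.IsMorita ∧ m.IsClassOf M :=
  ⟨fun _ hM ↦ ⟨_, hM.isStrict, rfl⟩, fun _ ↦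
    ⟨fun hm ↦ hm.exists_isMorita, fun ⟨_, hM, hm⟩ ↦ hM.isInvertible hm⟩⟩
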